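/- Let $\mathbb{K}$ be a field of characteristic zero. Partitions of finite linearly ordered sets are considered up to monotone bijection, so a partition of degree $n$ is a partition of $[n]=\{1,\dots,n\}$ into non-empty blocks; $P\le Q$ means that every block of $P$ is contained in a block of $Q$. $P$ is noncrossing if there are no $a<c<b<d$ with $a,b$ in one block and $c,d$ in another one. For $S\subseteq[n]$ let $P_{|S}$ be the partition of $S$ into the non-empty intersections of $S$ with blocks of $P$, regarded (by standardization) as a partition of $[\sharp S]$. Let $\mathrm{NCP}_0$ be the set of noncrossing partitions of all degrees $n\ge 0$, and $\mathrm{NCP}=\mathrm{NCP}_0\setminus\{\emptyset\}$; let $\mathrm{SP}_0$, $\mathrm{SP}$ be the corresponding sets of all partitions. For blocks $\pi,\sigma$ of $P$ write $\pi\to\sigma$ if $\sigma$ meets the interval $[\min\pi,\max\pi]$, and also write $\to$ for the transitive closure. A cut $(L,U)$ of $P$ is a splitting of the set of blocks into a lowerset $L$ ($\pi\in L$ and $\sigma\to\pi$ imply $\sigma\in L$) and the complementary upperset $U$. If $x_1<\dots<x_k$ are the elements of the blocks of $L$, put $D_i=\{y\in[n]: x_i<y<x_{i+1}\}$ for $0\le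 i\le k$, with $x_0=0$ and $x_{k+1}=n+1$. Let $B_{gap}^{NC}$ be the free unital associative $\mathbb{K}$-algebra on $\mathrm{NCP}_0$ (the generator $\emptyset$ is not the unit), with the algebra homomorphisms $\Delta_0$, $\varepsilon$ given on generators by $$\Delta_0(P)=\sum_{(L,U)\in\mathrm{cut}(P)}P_{|\{x_1,\dots,x_k\}}\otimes P_{|D_0}\cdot P_{|D_1}\cdots P_{|D_k},\qquad \varepsilon(\emptyset)=1,\quad \varepsilon(P)=0\ \text{ for } P\ne\emptyset .$$ Let $B_{bl}^{NC}$ be the free commutative $\mathbb{K}$-algebra on $\mathrm{NCP}$, with the algebra homomorphisms $\delta$, $\varepsilon_{bl}$ given on generators by $$\delta(P)=\sum_{P\le Q}Q\otimes P/Q,\qquad \varepsilon_{bl}(P)=1 \text{ if } P \text{ has exactly one block, and } 0 \text{ otherwise},$$ where $Q$ runs over the noncrossing partitions of the same degree that are coarser than or equal to $P$, and $P/Q=\prod_{\tau\in Q}P_{|\tau}\in B_{bl}^{NC}$ is a product over the blocks of $Q$. Let $\rho:B_{gap}^{NC}\to B_{gap}^{NC}\otimes B_{bl}^{NC}$ be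 the multiplicative map given on generators $P\in\mathrm{NCP}_0$ by the same formula $\rho(P)=\sum_{P\le Q}Q\otimes P/Q$; in particular $\rho(\emptyset)=\emptyset\otimes 1$. **Theorem.** The coaction $\rho$ makes $B_{gap}^{NC}$ a comodule bialgebra over $B_{bl}^{NC}$. That is, $(B_{gap}^{NC},\Delta_0,\varepsilon)$ and $(B_{bl}^{NC},\delta,\varepsilon_{bl})$ are bialgebras; $\rho$ is a right coaction, i.e. $(\rho\otimes\mathrm{Id})\circ\rho=(\mathrm{Id}\otimes\delta)\circ\rho$ and $(\mathrm{Id}\otimes\varepsilon_{bl})\circ\rho=\mathrm{Id}$; and for all $x,y\in B_{gap}^{NC}$ $$\rho(1)=1\otimes 1,\qquad \rho(x\cdot y)=\rho(x)\rho(y),\qquad (\varepsilon\otimes\mathrm{Id})\rho(x)=\varepsilon(x)1,$$ $$(\Delta_0\otimes\mathrm{Id})\rho(x)=(\mathrm{Id}\otimes\mathrm{Id}\otimes m)\circ(\mathrm{Id}\otimes\tau\otimes\mathrm{Id})\circ(\rho\otimes\rho)\circ\Delta_0(x),$$ where $m$ is the product of $B_{bl}^{NC}$ and $\tau$ is the swap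 map $B_{bl}^{NC}\otimes B_{gap}^{NC}\to B_{gap}^{NC}\otimes B_{bl}^{NC}$. The same holds for general set partitions, that is, with $\mathrm{NCP}_0$, $\mathrm{NCP}$ replaced by $\mathrm{SP}_0$, $\mathrm{SP}$ (and with all coarsenings $Q$ of $P$ in the sums). -/

import Mathlib

open scoped TensorProduct

noncomputable section

namespace PartitionBialgebra

/-! ### Bialgebras and comodule bialgebras -/

/-- The linear maps `Δ` and `ε` make the unital associative algebra `A` a bialgebra. -/
structure IsBialgebra (K : Type*) {A : Type*} [CommSemiring K] [Semiring A] [Algebra K A]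
    (Δ : A →ₗ[K] A ⊗[K] A) (ε : A →ₗ[K] K) : Prop where
  /-- coassociativity -/
  coassoc : (TensorProduct.assoc K A A A).toLinearMap ∘ₗ Δ.rTensor A ∘ₗ Δ = Δ.lTensor A ∘ₗ Δ
  /-- left counit law: `(ε ⊗ id) (Δ a) = 1 ⊗ a` -/
  counit_left : ε.rTensor A ∘ₗ Δ = TensorProduct.mk K K A 1
  /-- right counit law: `(id ⊗ ε) (Δ a) = a ⊗ 1` -/
  counit_right : ε.lTensor A ∘ₗ Δ = (TensorProduct.mk K A K).flip 1
  comul_one : Δ 1 = 1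
  comul_mul : ∀ a b : A, Δ (a * b) = Δ a * Δ b
  counit_one : ε 1 = 1
  counit_mul : ∀ a b : A, ε (a * b) = ε a * ε b

/-- `ρ` is a (coassociative and counital) right coaction on `A` of the coalgebra `(B, δ, εB)`. -/
structure IsRightCoaction (K : Type*) {A B : Type*} [CommSemiring K]
    [AddCommMonoid A] [Module K A] [AddCommMonoid B] [Module K B]
    (δ : B →ₗ[K] B ⊗[K] B) (εB : B →ₗ[K] K) (ρ : A →ₗ[K] A ⊗[K] B) : Prop where
  /-- `(ρ ⊗ id) ∘ ρ = (id ⊗ δ) ∘ ρ` -/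
  coassoc : (TensorProduct.assoc K A B B).toLinearMap ∘ₗ ρ.rTensor B ∘ₗ ρ = δ.lTensor A ∘ₗ ρ
  /-- `(id ⊗ εB) (ρ a) = a ⊗ 1` -/
  counit : εB.lTensor A ∘ₗ ρ = (TensorProduct.mk K A K).flip 1

/-- `(A, Δ, ε)`, with the right coaction `ρ`, is a comodule bialgebra over the commutative
bialgebra `(B, δ, εB)`: a bialgebra in the braided monoidal category of right `B`-comodules.  So
`A` and `B` are bialgebras, `ρ` is a right coaction, and the unit, the product, the counit and the
coproduct of `A` are morphisms of `B`-comodules. -/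
structure IsComoduleBialgebra (K : Type*) {A B : Type*} [CommSemiring K]
    [Semiring A] [Algebra K A] [CommSemiring B] [Algebra K B]
    (Δ : A →ₗ[K] A ⊗[K] A) (ε : A →ₗ[K] K) (δ : B →ₗ[K] B ⊗[K] B) (εB : B →ₗ[K] K)
    (ρ : A →ₗ[K] A ⊗[K] B) : Prop where
  bialgebra_left : IsBialgebra K Δ ε
  bialgebra_right : IsBialgebra K δ εB
  coaction : IsRightCoaction K δ εB ρ
  /-- `ρ 1 = 1 ⊗ 1` -/
  unital : ρ 1 = 1 ⊗ₜ[K] 1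
  /-- `ρ (a b) = ρ a ρ b` -/
  multiplicative : ∀ a b : A, ρ (a * b) = ρ a * ρ b
  /-- `(ε ⊗ id) (ρ a) = ε a • 1` -/
  counital : ∀ a : A, ε.rTensor B (ρ a) = ε a ⊗ₜ[K] (1 : B)
  /-- `(Δ ⊗ id) ∘ ρ = (id ⊗ id ⊗ m_B) ∘ (id ⊗ τ ⊗ id) ∘ (ρ ⊗ ρ) ∘ Δ` -/
  comul_colinear :
    Δ.rTensor B ∘ₗ ρ =
      (LinearMap.mul' K B).lTensor (A ⊗[K] A) ∘ₗ
        (TensorProduct.tensorTensorTensorComm K A B A B).toLinearMap ∘ₗ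
          TensorProduct.map ρ ρ ∘ₗ Δ

/-! ### Set partitions -/

/-- Partitions of the linearly ordered set `Fin n = {0 < ⋯ < n - 1}` into non-empty blocks, ordered
by coarsening: `P ≤ Q` means that every block of `P` is contained in a block of `Q`. -/
abbrev SetPartition (n : ℕ) : Type := Finpartition (Finset.univ : Finset (Fin n))

/-- A partition is noncrossing when there are no `a, b` in one block and `c, d` in another one with
`a < c < b < d`. -/
def IsNoncrossing {n : ℕ} (P : SetPartition n) : Prop :=
  ∀ π ∈ P.parts, ∀ σ ∈ P.parts, π ≠ σ →
    ∀ a ∈ π, ∀ b ∈ π, ∀ c ∈ σ, ∀ d ∈ σ, ¬ (a < c ∧ c < b ∧ b < d)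

/-- The subset of `Fin S.card` that corresponds to `b ∩ S` under the unique monotone bijection
`Fin S.card ≃ S`. -/
def standardizeSubset {n : ℕ} (S b : Finset (Fin n)) : Finset (Fin S.card) :=
  Finset.univ.filter fun i => S.orderEmbOfFin rfl i ∈ b

lemma mem_standardizeSubset {n : ℕ} {S b : Finset (Fin n)} {i : Fin S.card} :
    i ∈ standardizeSubset S b ↔ S.orderEmbOfFin rfl i ∈ b := by
  simp [standardizeSubset]

/-- The standardization of the restriction `P|_S`: its blocks are the non-empty sets among the
`π ∩ S`, `π` a block of `P`, transported to `Fin S.card` along the monotone bijection. -/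
def restrict {n : ℕ} (P : SetPartition n) (S : Finset (Fin n)) : SetPartition S.card :=
  Finpartition.ofErase (P.parts.image (standardizeSubset S))
    (by
      rw [Finset.supIndep_iff_pairwiseDisjoint]
      intro x hx y hy hxy
      simp only [Finset.coe_image, Set.mem_image, Finset.mem_coe] at hx hy
      obtain ⟨b, hb, rfl⟩ := hx
      obtain ⟨c, hc, rfl⟩ := hy
      rw [Function.onFun, id, id, Finset.disjoint_left]
      intro i hi hi'
      rw [mem_standardizeSubset] at hi hi'
      exact hxy (by rw [P.eq_of_mem_parts hb hc hi hi']))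
    (by
      ext i
      obtain ⟨t, ht, hit⟩ := P.exists_mem (Finset.mem_univ (S.orderEmbOfFin rfl i))
      simp only [Finset.mem_sup, Finset.mem_image, id, Finset.mem_univ, iff_true]
      exact ⟨_, ⟨t, ht, rfl⟩, mem_standardizeSubset.2 hit⟩)

lemma mem_parts_restrict {n : ℕ} {P : SetPartition n} {S : Finset (Fin n)}
    {x : Finset (Fin S.card)} :
    x ∈ (restrict P S).parts ↔ x ≠ ∅ ∧ ∃ b ∈ P.parts, standardizeSubset S b = x := by
  simp [restrict]

lemma IsNoncrossing.restrict {n : ℕ} {P : SetPartition n} (hP : IsNoncrossing P)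
    (S : Finset (Fin n)) : IsNoncrossing (restrict P S) := by
  intro π hπ σ hσ hne a ha b hb c hc d hd h
  obtain ⟨-, p, hp, rfl⟩ := mem_parts_restrict.1 hπ
  obtain ⟨-, q, hq, rfl⟩ := mem_parts_restrict.1 hσ
  rw [mem_standardizeSubset] at ha hb hc hd
  refine hP p hp q hq (fun e => hne (by rw [e])) _ ha _ hb _ hc _ hd ?_
  simpa using h

/-- A class of partitions stable under restriction.  It serves only to treat the class of all
partitions and the class of noncrossing partitions by the same formulas. -/
structure PartitionClass where
  Mem : ∀ {n : ℕ}, SetPartition n → Prop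
  mem_restrict : ∀ {n : ℕ} {P : SetPartition n}, Mem P →
    ∀ S : Finset (Fin n), Mem (restrict P S)

/-- All set partitions. -/
def allPartitions : PartitionClass where
  Mem := fun _ => True
  mem_restrict := fun _ _ => trivial

/-- Noncrossing partitions. -/
def noncrossingPartitions : PartitionClass where
  Mem := fun P => IsNoncrossing P
  mem_restrict := fun hP S => hP.restrict S

/-- The partitions in the class, of any degree, including the empty partition: this is `SP₀` for
the class of all partitions and `NCP₀` for the class of noncrossing ones. -/
structure Part₀ (F : PartitionClass) where
  deg : ℕ
  part : SetPartition deg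
  mem : F.Mem part

/-- The non-empty partitions in the class: `SP` or `NCP`. -/
def Part (F : PartitionClass) : Type := {P : Part₀ F // P.deg ≠ 0}

/-- The element `st(P|_S)` of `SP₀` or `NCP₀`. -/
def Part₀.st {F : PartitionClass} (P : Part₀ F) (S : Finset (Fin P.deg)) : Part₀ F :=
  ⟨S.card, restrict P.part S, F.mem_restrict P.mem S⟩

/-! ### Cuts -/

/-- `π ⟶ σ` for blocks of `P`: the convex hull of `π` meets `σ`. -/
def Arrow {n : ℕ} (P : SetPartition n) (π σ : Finset (Fin n)) : Prop :=
  π ∈ P.parts ∧ σ ∈ P.parts ∧ ∃ x ∈ σ, ∃ a ∈ π, ∃ b ∈ π, a ≤ x ∧ x ≤ b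

/-- The preorder on the blocks of `P` generated by `π ⟶ σ`. -/
def BlockPreorder {n : ℕ} (P : SetPartition n) : Finset (Fin n) → Finset (Fin n) → Prop :=
  Relation.TransGen (Arrow P)

open Classical in
/-- The lowersets of `P`: the sets `L` of blocks such that `π ∈ L` and `σ ⟶ π` imply `σ ∈ L`.  A cut
`(L, U)` of `P` is the same as a lowerset `L`, with `U` the complementary upperset. -/
def lowersets {n : ℕ} (P : SetPartition n) : Finset (Finset (Finset (Fin n))) :=
  P.parts.powerset.filter fun L => ∀ π ∈ L, ∀ σ, BlockPreorder P σ π → σ ∈ L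

/-- The underlying set of a set of blocks. -/
def support {n : ℕ} (L : Finset (Finset (Fin n))) : Finset (Fin n) := L.biUnion id

/-- The gap `D_i` of `X = {x_1 < ⋯ < x_k}`: the set of all `y ∉ X` with exactly `i` elements of `X`
below `y`, that is, with `x_i < y < x_{i+1}` (no lower bound if `i = 0`, no upper one if
`i = k`). -/
def gap {n : ℕ} (X : Finset (Fin n)) (i : ℕ) : Finset (Fin n) :=
  Finset.univ.filter fun y => y ∉ X ∧ (X.filter (· < y)).card = i

section Algebra

variable (K : Type*) [CommSemiring K] (F : PartitionClass)

/-! ### The gap-insertion bialgebra -/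

/-- The free unital associative algebra on `SP₀` or `NCP₀`.  The empty partition is one of the
generators; it is not the unit. -/
abbrev BGap : Type _ := FreeAlgebra K (Part₀ F)

variable {F} in
/-- The gap monomial `st(P|_{D_0}) ⋯ st(P|_{D_k})` of the upperset complementary to the lowerset `L`,
where `D_0, …, D_k` are the gaps of the underlying set of `L`, which has `k` elements. -/
def gapMonomial (P : Part₀ F) (L : Finset (Finset (Fin P.deg))) : BGap K F :=
  (List.ofFn fun i : Fin ((support L).card + 1) =>
    FreeAlgebra.ι K (P.st (gap (support L) i))).prod

/-- The cut coproduct: the algebra homomorphism with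
`Δ₀ P = ∑_{(L, U) ∈ cut P} st L ⊗ (gap monomial of U)` for every partition `P`. -/
def cutCoproduct : BGap K F →ₐ[K] BGap K F ⊗[K] BGap K F :=
  FreeAlgebra.lift K fun P =>
    ∑ L ∈ lowersets P.part, FreeAlgebra.ι K (P.st (support L)) ⊗ₜ[K] gapMonomial K P L

/-- The counit: `1` on the empty partition and `0` on every other partition. -/
def gapCounit : BGap K F →ₐ[K] K :=
  FreeAlgebra.lift K fun P => if P.deg = 0 then 1 else 0

/-! ### The block-substitution bialgebra -/

/-- The free commutative algebra on `SP` or `NCP`. -/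
abbrev BBl : Type _ := MvPolynomial (Part F) K

variable {F} in
open Classical in
/-- The coarsenings `Q ≥ P` of `P` in the class. -/
def coarsenings (P : Part₀ F) : Finset (SetPartition P.deg) :=
  Finset.univ.filter fun Q => P.part ≤ Q ∧ F.Mem Q

variable {F} in
/-- The monomial `P / Q = st(P|_{τ_1}) ⋯ st(P|_{τ_l})`, where `τ_1, …, τ_l` are the blocks of `Q`. -/
def fibreMonomial (P : Part₀ F) (Q : SetPartition P.deg) : BBl K F :=
  ∏ τ : {τ // τ ∈ Q.parts},
    MvPolynomial.X ⟨P.st τ.1, Finset.card_ne_zero.2 (Q.nonempty_of_mem_parts τ.2)⟩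

open Classical in
/-- The refinement coproduct: the algebra homomorphism with `δ P = ∑_{P ≤ Q} Q ⊗ P / Q` for every
non-empty partition `P`, where `Q` runs through the class. -/
def refinementCoproduct : BBl K F →ₐ[K] BBl K F ⊗[K] BBl K F :=
  MvPolynomial.aeval fun P =>
    ∑ Q : {Q // Q ∈ coarsenings P.1},
      MvPolynomial.X ⟨⟨P.1.deg, Q.1, (Finset.mem_filter.1 Q.2).2.2⟩, P.2⟩ ⊗ₜ[K]
        fibreMonomial K P.1 Q.1

/-- The counit: `1` on every partition with exactly one block and `0` on the other non-empty
partitions. -/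
def blockCounit : BBl K F →ₐ[K] K :=
  MvPolynomial.aeval fun P => if P.1.part.parts.card = 1 then 1 else 0

/-! ### The coaction -/

open Classical in
/-- The refinement coaction: the algebra homomorphism with `ρ P = ∑_{P ≤ Q} Q ⊗ P / Q` for every
partition `P` (the empty one included), where `Q` runs through the class. -/
def refinementCoaction : BGap K F →ₐ[K] BGap K F ⊗[K] BBl K F :=
  FreeAlgebra.lift K fun P =>
    ∑ Q : {Q // Q ∈ coarsenings P},
      FreeAlgebra.ι K (⟨P.deg, Q.1, (Finset.mem_filter.1 Q.2).2.2⟩ : Part₀ F) ⊗ₜ[K]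
        fibreMonomial K P Q.1

end Algebra

end PartitionBialgebra

end

/-!
All maps are algebra homomorphisms, so every identity needs to be checked on a single partition `P`
only. There it becomes an identity between two sums whose terms are products of restrictions
`st(P|_S)`, `st(Q|_S)` to subsets of the ground set of `P`: iterated restrictions are restrictions
(`Part₀.st_st`), so all standardizations can be undone.

The index sets of the two sums are matched by one principle. Let a colouring of the ground set be
constant on the blocks of `P`. Then a coarsening of `P` that refines the partition into the fibres of
the colouring is the same as a family of coarsenings of the restrictions of `P` to the fibres
(`sum_coarsenings_eq_sum_pi`), and fibre monomials factor accordingly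
(`fibreMonomial_eq_prod_of_isFibres`).

* If the fibres are the blocks of a coarsening `R`, this computes `δ (P / R)`, and both sides of the
  coassociativity of `δ` and of `ρ` become sums over chains `P ≤ Q ≤ R` (`sum_coarsenings_coassoc`).
* A lowerset of `P` is determined by its underlying set `X`, and the sets `X` that occur are those for
  which every block of `P` lies in `X` or in one gap of `X` (`mem_lowersets`, `isCut_iff_le`). If the
  fibres are `X` and its gaps, the principle identifies both sides of the compatibility of `Δ₀` with
  `ρ` with a sum over the pairs of a coarsening `Q` of `P` and a cut of `Q` (`sum_coarsenings_cut`).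

Coassociativity of `Δ₀` is similar: both sides are sums over the nested pairs `Y ⊆ X` of cuts, a cut
`X` containing `Y` being a family of cuts of the restrictions to the gaps of `Y`
(`sum_cuts_superset`). The order of the factors is kept because the list of the gaps of `X` is the
concatenation, over the gaps `D` of `Y`, of the lists of the gaps of `D ∩ X` in `D`
(`gapList_eq_flatMap`).

About the class of partitions, the argument only uses that it is stable under restriction and
substitution and contains the partitions into a set and its gaps (`isComoduleBialgebra`). Noncrossing
partitions have these properties, since two blocks of a crossing cannot be separated by a noncrossing
coarsening.
-/

open scoped TensorProduct

namespace PartitionBialgebra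

/-! ### Set partitions as equivalence relations -/

/-- The points `i` and `j` lie in the same block of `P`. -/
def SameBlock {n : ℕ} (P : SetPartition n) (i j : Fin n) : Prop := P.part i = P.part j

section SameBlock

variable {n : ℕ} {P Q : SetPartition n} {i j k : Fin n}

lemma SameBlock.refl (P : SetPartition n) (i : Fin n) : SameBlock P i i := Eq.refl _

lemma SameBlock.symm (h : SameBlock P i j) : SameBlock P j i := Eq.symm h

lemma SameBlock.trans (h : SameBlock P i j) (h' : SameBlock P j k) : SameBlock P i k :=
  Eq.trans h h'

lemma sameBlock_iff_exists : SameBlock P i j ↔ ∃ b ∈ P.parts, i ∈ b ∧ j ∈ b := by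
  rw [SameBlock, ← P.mem_part_iff_part_eq_part (Finset.mem_univ _) (Finset.mem_univ _),
    P.mem_part_iff_exists]

lemma SameBlock.mem {b : Finset (Fin n)} (h : SameBlock P i j) (hb : b ∈ P.parts) (hi : i ∈ b) :
    j ∈ b := by
  obtain ⟨c, hc, hic, hjc⟩ := sameBlock_iff_exists.1 h
  rwa [P.eq_of_mem_parts hb hc hi hic]

lemma sameBlock_of_mem {b : Finset (Fin n)} (hb : b ∈ P.parts) (hi : i ∈ b) (hj : j ∈ b) :
    SameBlock P i j :=
  sameBlock_iff_exists.2 ⟨b, hb, hi, hj⟩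

lemma part_mem_parts (P : SetPartition n) (i : Fin n) : P.part i ∈ P.parts :=
  P.part_mem.2 (Finset.mem_univ i)

lemma mem_part_self (P : SetPartition n) (i : Fin n) : i ∈ P.part i :=
  P.mem_part_self.2 (Finset.mem_univ i)

lemma mem_part_iff : j ∈ P.part i ↔ SameBlock P i j :=
  ⟨fun h => sameBlock_of_mem (part_mem_parts P i) (mem_part_self P i) h,
    fun h => h.mem (part_mem_parts P i) (mem_part_self P i)⟩

lemma le_iff_sameBlock : P ≤ Q ↔ ∀ i j, SameBlock P i j → SameBlock Q i j := by
  refine ⟨fun h i j hij => ?_, fun h b hb => ?_⟩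
  · obtain ⟨b, hb, hi, hj⟩ := sameBlock_iff_exists.1 hij
    obtain ⟨c, hc, hbc⟩ := h hb
    exact sameBlock_of_mem hc (hbc hi) (hbc hj)
  · obtain ⟨i, hi⟩ := P.nonempty_of_mem_parts hb
    exact ⟨Q.part i, part_mem_parts Q i, fun j hj =>
      mem_part_iff.2 (h i j (sameBlock_of_mem hb hi hj))⟩

lemma setPartition_ext (h : ∀ i j, SameBlock P i j ↔ SameBlock Q i j) : P = Q :=
  le_antisymm (le_iff_sameBlock.2 fun i j => (h i j).1) (le_iff_sameBlock.2 fun i j => (h i j).2)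

lemma isNoncrossing_iff : IsNoncrossing P ↔
    ∀ a b c d, SameBlock P a b → SameBlock P c d → a < c → c < b → b < d → SameBlock P a c := by
  refine ⟨fun h a b c d hab hcd h1 h2 h3 => ?_, fun h π hπ σ hσ hne a ha b hb c hc d hd hlt => ?_⟩
  · by_contra hac
    exact h _ (part_mem_parts P a) _ (part_mem_parts P c) hac a (mem_part_self P a) b
      (mem_part_iff.2 hab) c (mem_part_self P c) d (mem_part_iff.2 hcd) ⟨h1, h2, h3⟩
  · have := h a b c d (sameBlock_of_mem hπ ha hb) (sameBlock_of_mem hσ hc hd) hlt.1 hlt.2.1 hlt.2.2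
    exact hne (P.eq_of_mem_parts hπ hσ ha (this.symm.mem hσ hc))

lemma card_parts_eq_one_iff : P.parts.card = 1 ↔ n ≠ 0 ∧ ∀ i j, SameBlock P i j := by
  rw [Finset.card_eq_one]
  constructor
  · rintro ⟨b, hb⟩
    have hmem : b ∈ P.parts := by simp [hb]
    refine ⟨?_, fun i j => ?_⟩
    · obtain ⟨i, -⟩ := P.nonempty_of_mem_parts hmem
      exact (Fin.pos i).ne'
    · have hi := part_mem_parts P i
      have hj := part_mem_parts P j
      rw [hb, Finset.mem_singleton] at hi hj
      exact hi.trans hj.symm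
  · rintro ⟨hn, h⟩
    let i : Fin n := ⟨0, Nat.pos_of_ne_zero hn⟩
    refine ⟨P.part i, Finset.eq_singleton_iff_unique_mem.2 ⟨part_mem_parts P i, fun b hb => ?_⟩⟩
    obtain ⟨j, hj⟩ := P.nonempty_of_mem_parts hb
    rw [← P.part_eq_of_mem hb hj]
    exact h j i

end SameBlock

/-! ### Standardization -/

/-- The subset of `S` that corresponds to `T` under the monotone bijection `Fin S.card ≃ S`. -/
def unstandardize {n : ℕ} (S : Finset (Fin n)) (T : Finset (Fin S.card)) : Finset (Fin n) :=
  T.map (S.orderEmbOfFin rfl).toEmbedding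

section Standardize

variable {n : ℕ} {S : Finset (Fin n)}

lemma exists_orderEmbOfFin_eq {x : Fin n} (hx : x ∈ S) : ∃ i, S.orderEmbOfFin rfl i = x := by
  have : x ∈ Set.range (S.orderEmbOfFin rfl) := by simpa using hx
  exact this

lemma mem_unstandardize_orderEmb {T : Finset (Fin S.card)} {i : Fin S.card} :
    S.orderEmbOfFin rfl i ∈ unstandardize S T ↔ i ∈ T := by
  simp [unstandardize]

lemma mem_unstandardize {T : Finset (Fin S.card)} {x : Fin n} :
    x ∈ unstandardize S T ↔ ∃ i ∈ T, S.orderEmbOfFin rfl i = x := by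
  simp [unstandardize]

lemma unstandardize_subset (T : Finset (Fin S.card)) : unstandardize S T ⊆ S := by
  intro x hx
  obtain ⟨i, -, rfl⟩ := mem_unstandardize.1 hx
  exact S.orderEmbOfFin_mem rfl i

lemma card_unstandardize (T : Finset (Fin S.card)) : (unstandardize S T).card = T.card :=
  Finset.card_map _

lemma standardizeSubset_unstandardize (T : Finset (Fin S.card)) :
    standardizeSubset S (unstandardize S T) = T := by
  ext i
  rw [mem_standardizeSubset, mem_unstandardize_orderEmb]

lemma unstandardize_standardizeSubset (S b : Finset (Fin n)) :
    unstandardize S (standardizeSubset S b) = S ∩ b := by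
  ext x
  rw [mem_unstandardize, Finset.mem_inter]
  constructor
  · rintro ⟨i, hi, rfl⟩
    exact ⟨S.orderEmbOfFin_mem rfl i, mem_standardizeSubset.1 hi⟩
  · rintro ⟨hS, hb⟩
    obtain ⟨i, rfl⟩ := exists_orderEmbOfFin_eq hS
    exact ⟨i, mem_standardizeSubset.2 hb, rfl⟩

lemma sameBlock_restrict {P : SetPartition n} {i j : Fin S.card} :
    SameBlock (restrict P S) i j ↔
      SameBlock P (S.orderEmbOfFin rfl i) (S.orderEmbOfFin rfl j) := by
  rw [sameBlock_iff_exists, sameBlock_iff_exists]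
  constructor
  · rintro ⟨b, hb, hi, hj⟩
    obtain ⟨-, c, hc, rfl⟩ := mem_parts_restrict.1 hb
    exact ⟨c, hc, mem_standardizeSubset.1 hi, mem_standardizeSubset.1 hj⟩
  · rintro ⟨c, hc, hi, hj⟩
    refine ⟨standardizeSubset S c, mem_parts_restrict.2 ⟨?_, c, hc, rfl⟩,
      mem_standardizeSubset.2 hi, mem_standardizeSubset.2 hj⟩
    exact Finset.ne_empty_of_mem (mem_standardizeSubset.2 hi)

end Standardize

variable {F : PartitionClass}

/-- Partitions are determined up to monotone bijection of the underlying sets. -/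
lemma Part₀.ext_of_orderIso {P P' : Part₀ F} (e : Fin P.deg ≃o Fin P'.deg)
    (h : ∀ i j, SameBlock P.part i j ↔ SameBlock P'.part (e i) (e j)) : P = P' := by
  obtain ⟨n, p, hp⟩ := P
  obtain ⟨n', p', hp'⟩ := P'
  obtain rfl : n = n' := by simpa using Fintype.card_congr e.toEquiv
  obtain rfl : e = OrderIso.refl _ := Subsingleton.elim _ _
  obtain rfl : p = p' := setPartition_ext h
  rfl

lemma Part₀.deg_st_eq_zero_iff {P : Part₀ F} {S : Finset (Fin P.deg)} :
    (P.st S).deg = 0 ↔ S = ∅ :=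
  Finset.card_eq_zero

lemma Part₀.st_univ (P : Part₀ F) : P.st Finset.univ = P := by
  refine Part₀.ext_of_orderIso
    ((Finset.univ.orderIsoOfFin rfl).trans ⟨⟨fun x => x.1, fun x => ⟨x, Finset.mem_univ x⟩,
      fun _ => rfl, fun _ => rfl⟩, Iff.rfl⟩) fun i j => ?_
  exact sameBlock_restrict

lemma orderEmbOfFin_orderEmbOfFin {n : ℕ} (S : Finset (Fin n)) (T : Finset (Fin S.card))
    (i : Fin T.card) :
    S.orderEmbOfFin rfl (T.orderEmbOfFin rfl i) =
      (unstandardize S T).orderEmbOfFin rfl (Fin.cast (card_unstandardize T).symm i) := by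
  have h := Finset.orderEmbOfFin_unique (card_unstandardize T)
    (f := fun i => S.orderEmbOfFin rfl (T.orderEmbOfFin rfl i))
    (fun i => mem_unstandardize_orderEmb.2 (T.orderEmbOfFin_mem rfl i))
    ((S.orderEmbOfFin rfl).strictMono.comp (T.orderEmbOfFin rfl).strictMono)
  exact congrFun h i

/-- Transitivity of restriction: iterated restrictions are restrictions to subsets of the original
set. -/
lemma Part₀.st_st (P : Part₀ F) (S : Finset (Fin P.deg)) (T : Finset (Fin S.card)) :
    (P.st S).st T = P.st (unstandardize S T) := by
  refine Part₀.ext_of_orderIso (Fin.castOrderIso (card_unstandardize T).symm) fun i j => ?_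
  refine (sameBlock_restrict.trans sameBlock_restrict).trans (Iff.trans ?_ sameBlock_restrict.symm)
  exact iff_of_eq (congrArg₂ (SameBlock P.part) (orderEmbOfFin_orderEmbOfFin S T i)
    (orderEmbOfFin_orderEmbOfFin S T j))

lemma Part₀.st_st_standardizeSubset (P : Part₀ F) (S b : Finset (Fin P.deg)) :
    (P.st S).st (standardizeSubset S b) = P.st (S ∩ b) :=
  (P.st_st S _).trans (by rw [unstandardize_standardizeSubset])

/-! ### Gluing partitions along a colouring -/

open Classical in
/-- The partition of `Fin n` into the non-empty fibres of the colouring `c`. -/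
noncomputable def kernelPartition {n : ℕ} {ι : Type*} (c : Fin n → ι) : SetPartition n :=
  Finpartition.ofSetoid (Setoid.ker c)

lemma sameBlock_kernelPartition {n : ℕ} {ι : Type*} {c : Fin n → ι} {i j : Fin n} :
    SameBlock (kernelPartition c) i j ↔ c i = c j := by
  classical
  rw [← mem_part_iff, kernelPartition, Finpartition.mem_part_ofSetoid_iff_rel]
  rfl

lemma le_kernelPartition {n : ℕ} {ι : Type*} {c : Fin n → ι} {P : SetPartition n} :
    P ≤ kernelPartition c ↔ ∀ i j, SameBlock P i j → c i = c j := by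
  simp only [le_iff_sameBlock, sameBlock_kernelPartition]

/-- The finsets `S j` are the fibres of the colouring `c`. -/
def IsFibres {n : ℕ} {ι : Type*} (c : Fin n → ι) (S : ι → Finset (Fin n)) : Prop :=
  ∀ x j, x ∈ S j ↔ c x = j

section Glue

variable {n : ℕ} {ι : Type*} {c : Fin n → ι} {S : ι → Finset (Fin n)}

lemma IsFibres.eq_of_mem_parts (hS : IsFibres c S) {τ : Finset (Fin n)}
    (hτ : τ ∈ (kernelPartition c).parts) : ∃ j, τ = S j := by
  obtain ⟨x, hx⟩ := (kernelPartition c).nonempty_of_mem_parts hτ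
  refine ⟨c x, Finset.ext fun y => ?_⟩
  rw [hS]
  exact ⟨fun hy => sameBlock_kernelPartition.1 (sameBlock_of_mem hτ hy hx),
    fun h => (sameBlock_kernelPartition.2 h.symm).mem hτ hx⟩

/-- Partitions of the fibres of a colouring glue to a partition of the whole set. -/
lemma IsFibres.exists_glue (hS : IsFibres c S) (q : ∀ j, SetPartition (S j).card) :
    ∃ Q ≤ kernelPartition c, ∀ j, restrict Q (S j) = q j := by
  classical
  let r : Fin n → Fin n → Prop := fun x y => ∃ j a b, (S j).orderEmbOfFin rfl a = x ∧
    (S j).orderEmbOfFin rfl b = y ∧ SameBlock (q j) a b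
  have hcol : ∀ j a, c ((S j).orderEmbOfFin rfl a) = j := fun j a =>
    (hS _ j).1 ((S j).orderEmbOfFin_mem rfl a)
  let s : Setoid (Fin n) :=
    { r := r
      iseqv :=
        { refl := fun x => by
            obtain ⟨a, ha⟩ := exists_orderEmbOfFin_eq ((hS x (c x)).2 rfl)
            exact ⟨c x, a, a, ha, ha, SameBlock.refl _ _⟩
          symm := by
            rintro x y ⟨j, a, b, ha, hb, h⟩
            exact ⟨j, b, a, hb, ha, h.symm⟩
          trans := by
            rintro x y z ⟨j, a, b, ha, hb, h⟩ ⟨j', a', b', ha', hb', h'⟩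
            obtain rfl : j = j' := by rw [← hcol j b, ← hcol j' a', hb, ha']
            obtain rfl : b = a' := ((S j).orderEmbOfFin rfl).injective (hb.trans ha'.symm)
            exact ⟨j, a, b', ha, hb', h.trans h'⟩ } }
  have hs : ∀ x y, SameBlock (Finpartition.ofSetoid s) x y ↔ r x y := fun x y => by
    rw [← mem_part_iff, Finpartition.mem_part_ofSetoid_iff_rel]
    rfl
  refine ⟨Finpartition.ofSetoid s, le_kernelPartition.2 fun x y h => ?_, fun j => ?_⟩
  · obtain ⟨j, a, b, rfl, rfl, -⟩ := (hs x y).1 h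
    rw [hcol, hcol]
  · refine setPartition_ext fun a b => ?_
    rw [sameBlock_restrict, hs]
    refine ⟨?_, fun h => ⟨j, a, b, rfl, rfl, h⟩⟩
    rintro ⟨j', a', b', ha, hb, h⟩
    obtain rfl : j' = j := by rw [← hcol j' a', ha, hcol]
    obtain rfl := ((S j').orderEmbOfFin rfl).injective ha
    obtain rfl := ((S j').orderEmbOfFin rfl).injective hb
    exact h

/-- A refinement of the fibre partition is determined by its restrictions to the fibres. -/
lemma IsFibres.le_of_restrict_le (hS : IsFibres c S) {P Q : SetPartition n}
    (hP : P ≤ kernelPartition c) (h : ∀ j, restrict P (S j) ≤ restrict Q (S j)) : P ≤ Q := by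
  refine le_iff_sameBlock.2 fun x y hxy => ?_
  obtain ⟨j, hj⟩ : ∃ j, c x = j := ⟨_, rfl⟩
  have hj' : c y = j := (le_kernelPartition.1 hP x y hxy).symm.trans hj
  obtain ⟨a, rfl⟩ := exists_orderEmbOfFin_eq ((hS x j).2 hj)
  obtain ⟨b, rfl⟩ := exists_orderEmbOfFin_eq ((hS y j).2 hj')
  exact sameBlock_restrict.1 (le_iff_sameBlock.1 (h _) _ _ (sameBlock_restrict.2 hxy))

end Glue

lemma restrict_mono {n : ℕ} {P Q : SetPartition n} (h : P ≤ Q) (S : Finset (Fin n)) :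
    restrict P S ≤ restrict Q S :=
  le_iff_sameBlock.2 fun _ _ hab =>
    sameBlock_restrict.2 (le_iff_sameBlock.1 h _ _ (sameBlock_restrict.1 hab))

/-! ### Gaps -/

/-- The colour of a point with respect to `X`: `none` on `X`, and the index of its gap off `X`. -/
def gapColor {n : ℕ} (X : Finset (Fin n)) (x : Fin n) : Option (Fin (X.card + 1)) :=
  if x ∈ X then none
  else some ⟨(X.filter (· < x)).card, Nat.lt_succ_of_le (Finset.card_filter_le _ _)⟩

/-- The set `X` and its gaps, as one family. -/
def gapFamily {n : ℕ} (X : Finset (Fin n)) : Option (Fin (X.card + 1)) → Finset (Fin n)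
  | none => X
  | some i => gap X i

lemma mem_gap {n : ℕ} {X : Finset (Fin n)} {i : ℕ} {y : Fin n} :
    y ∈ gap X i ↔ y ∉ X ∧ (X.filter (· < y)).card = i := by
  simp [gap]

lemma isFibres_gap {n : ℕ} (X : Finset (Fin n)) : IsFibres (gapColor X) (gapFamily X) := by
  rintro x (_ | i)
  · by_cases hx : x ∈ X <;> simp [gapColor, gapFamily, hx]
  · by_cases hx : x ∈ X <;> simp [gapColor, gapFamily, hx, mem_gap, Fin.ext_iff]

/-- Two points lie in the same gap of `X` exactly when `X` does not meet the interval between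
them. -/
lemma gapColor_eq_iff {n : ℕ} {X : Finset (Fin n)} {x y : Fin n} (hxy : x ≤ y)
    (hx : x ∉ X) : gapColor X x = gapColor X y ↔ ∀ z ∈ X, x ≤ z → ¬ z ≤ y := by
  have hsub : X.filter (· < x) ⊆ X.filter (· < y) :=
    Finset.monotone_filter_right _ fun z _ hz => lt_of_lt_of_le hz hxy
  constructor
  · intro h z hz hxz hzy
    by_cases hy : y ∈ X
    · simp [gapColor, hx, hy] at h
    · simp only [gapColor, hx, hy, if_false, Option.some.injEq, Fin.mk.injEq] at h
      have heq := Finset.eq_of_subset_of_card_le hsub h.ge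
      have hz' : z ∈ X.filter (· < y) :=
        Finset.mem_filter.2 ⟨hz, lt_of_le_of_ne hzy fun e => hy (e ▸ hz)⟩
      rw [← heq] at hz'
      exact absurd (Finset.mem_filter.1 hz').2 (not_lt.2 hxz)
  · intro h
    have hy : y ∉ X := fun hy => h y hy hxy le_rfl
    have heq : X.filter (· < x) = X.filter (· < y) := by
      refine hsub.antisymm fun z hz => ?_
      obtain ⟨hzX, hzy⟩ := Finset.mem_filter.1 hz
      refine Finset.mem_filter.2 ⟨hzX, ?_⟩
      by_contra hxz
      exact h z hzX (not_lt.1 hxz) hzy.le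
    simp [gapColor, hx, hy, heq]

/-- `X` is the underlying set of a lowerset of `P`: two points of a block lie both in `X`, or both off
`X` with no element of `X` between them.  Since `z = x` and `z = y` are allowed, the one condition
below says both. -/
def IsCut {n : ℕ} (P : SetPartition n) (X : Finset (Fin n)) : Prop :=
  ∀ x y, SameBlock P x y → ∀ z ∈ X, x ≤ z → z ≤ y → x ∈ X ∧ y ∈ X

/-- Cuts, seen as partitions coarser than `P`: every block of `P` is contained in `X` or in one gap of
`X`. This puts cuts on the same footing as coarsenings. -/
lemma isCut_iff_le {n : ℕ} {P : SetPartition n} {X : Finset (Fin n)} :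
    IsCut P X ↔ P ≤ kernelPartition (gapColor X) := by
  rw [le_kernelPartition]
  constructor
  · have key : IsCut P X → ∀ x y, x ≤ y → SameBlock P x y → gapColor X x = gapColor X y := by
      intro h x y hxy hP
      by_cases hx : x ∈ X
      · have hy := (h x y hP x hx le_rfl hxy).2
        simp [gapColor, hx, hy]
      · exact (gapColor_eq_iff hxy hx).2 fun z hz hxz hzy => hx (h x y hP z hz hxz hzy).1
    intro h x y hP
    rcases le_total x y with hxy | hxy
    · exact key h x y hxy hP
    · exact (key h y x hxy hP.symm).symm
  · intro h x y hP z hz hxz hzy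
    have hc := h x y hP
    by_cases hx : x ∈ X
    · refine ⟨hx, ?_⟩
      by_contra hy
      simp [gapColor, hx, hy] at hc
    · exact absurd hzy ((gapColor_eq_iff (hxz.trans hzy) hx).1 hc z hz hxz)

/-- The set `X` and its non-empty gaps form a noncrossing partition. -/
lemma isNoncrossing_kernelPartition_gapColor {n : ℕ} (X : Finset (Fin n)) :
    IsNoncrossing (kernelPartition (gapColor X)) := by
  refine isNoncrossing_iff.2 fun a b c d hab hcd hac hcb hbd => ?_
  rw [sameBlock_kernelPartition] at *
  by_cases ha : a ∈ X
  · by_cases hc : c ∈ X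
    · simp [gapColor, ha, hc]
    · have hb : b ∈ X := by
        by_contra hb
        simp [gapColor, ha, hb] at hab
      exact absurd hbd.le ((gapColor_eq_iff (hcb.trans hbd).le hc).1 hcd b hb hcb.le)
  · exact (gapColor_eq_iff hac.le ha).2 fun z hz haz hzc =>
      (gapColor_eq_iff (hac.trans hcb).le ha).1 hab z hz haz (hzc.trans hcb.le)

/-! ### Classes stable under substitution -/

/-- A class of partitions stable under substitution: it contains a partition as soon as it contains
some coarsening and the restrictions to the blocks of this coarsening.  It also contains the
partitions into a set and its gaps, among them those with a single block. -/
structure PartitionClass.IsSubstitutive (F : PartitionClass) : Prop where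
  mem_of_restrict : ∀ {n : ℕ} {P R : SetPartition n}, P ≤ R → F.Mem R →
    (∀ τ ∈ R.parts, F.Mem (restrict P τ)) → F.Mem P
  mem_gaps : ∀ {n : ℕ} (X : Finset (Fin n)), F.Mem (kernelPartition (gapColor X))

lemma isSubstitutive_allPartitions : allPartitions.IsSubstitutive :=
  ⟨fun _ _ _ => trivial, fun _ => trivial⟩

/-- A crossing of `P` either is a crossing of the coarser partition `R` or lies inside a block of
`R`. -/
lemma isSubstitutive_noncrossingPartitions : noncrossingPartitions.IsSubstitutive := by
  refine ⟨fun {n P R} hPR hR h => ?_, isNoncrossing_kernelPartition_gapColor⟩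
  refine isNoncrossing_iff.2 fun a b c d hab hcd hac hcb hbd => ?_
  have hle := le_iff_sameBlock.1 hPR
  have hR' : SameBlock R a c := isNoncrossing_iff.1 hR a b c d (hle _ _ hab) (hle _ _ hcd) hac hcb hbd
  -- all four points lie in one block of `R`, on which `P` is noncrossing
  obtain ⟨τ, hτ, ha, hc⟩ := sameBlock_iff_exists.1 hR'
  obtain ⟨b, rfl⟩ := exists_orderEmbOfFin_eq ((hle _ _ hab).mem hτ ha)
  obtain ⟨d, rfl⟩ := exists_orderEmbOfFin_eq ((hle _ _ hcd).mem hτ hc)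
  obtain ⟨a, rfl⟩ := exists_orderEmbOfFin_eq ha
  obtain ⟨c, rfl⟩ := exists_orderEmbOfFin_eq hc
  simp only [OrderEmbedding.lt_iff_lt] at hac hcb hbd
  exact sameBlock_restrict.1 (isNoncrossing_iff.1 (h τ hτ) a b c d
    (sameBlock_restrict.2 hab) (sameBlock_restrict.2 hcd) hac hcb hbd)

lemma PartitionClass.IsSubstitutive.mem_of_isFibres {F : PartitionClass} (hF : F.IsSubstitutive)
    {n : ℕ} {ι : Type*} {c : Fin n → ι} {S : ι → Finset (Fin n)} (hS : IsFibres c S)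
    (hc : F.Mem (kernelPartition c)) {P : SetPartition n} (hP : P ≤ kernelPartition c)
    (h : ∀ j, F.Mem (restrict P (S j))) : F.Mem P := by
  refine hF.mem_of_restrict hP hc fun τ hτ => ?_
  obtain ⟨j, rfl⟩ := hS.eq_of_mem_parts hτ
  exact h j

/-! ### Coarsenings -/

/-- The coarsenings of `P` in the class, as a type. -/
abbrev Coarsening (P : Part₀ F) : Type := {Q // Q ∈ coarsenings P}

lemma mem_coarsenings {P : Part₀ F} {Q : SetPartition P.deg} :
    Q ∈ coarsenings P ↔ P.part ≤ Q ∧ F.Mem Q := by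
  simp [coarsenings]

lemma Coarsening.le {P : Part₀ F} (Q : Coarsening P) : P.part ≤ Q.1 := (mem_coarsenings.1 Q.2).1

lemma Coarsening.mem {P : Part₀ F} (Q : Coarsening P) : F.Mem Q.1 := (mem_coarsenings.1 Q.2).2

/-- A coarsening of `P` as an element of the class. -/
def Coarsening.toPart₀ {P : Part₀ F} (Q : Coarsening P) : Part₀ F := ⟨P.deg, Q.1, Q.mem⟩

/-- `P` as a coarsening of itself. -/
def Coarsening.refl (P : Part₀ F) : Coarsening P := ⟨P.part, mem_coarsenings.2 ⟨le_rfl, P.mem⟩⟩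

/-- The empty partition has one coarsening only. -/
lemma sum_coarsenings_of_deg_eq_zero {P : Part₀ F} (h : P.deg = 0) {M : Type*} [AddCommMonoid M]
    (f : Coarsening P → M) : ∑ Q, f Q = f (Coarsening.refl P) := by
  have : IsEmpty (Fin P.deg) := by rw [h]; infer_instance
  refine Finset.sum_eq_single_of_mem _ (Finset.mem_univ _) fun Q _ hQ => absurd ?_ hQ
  exact Subtype.ext (setPartition_ext fun i => isEmptyElim i)

/-- The restriction of a coarsening of `P` to `S`, a coarsening of `st(P|_S)`. -/
def Coarsening.restr {P : Part₀ F} (Q : Coarsening P) (S : Finset (Fin P.deg)) :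
    Coarsening (P.st S) :=
  ⟨restrict Q.1 S, mem_coarsenings.2 ⟨restrict_mono Q.le S, F.mem_restrict Q.mem S⟩⟩

/-- The bijection between the coarsenings of `P` that refine the fibre partition of a colouring and
the families of coarsenings of the restrictions of `P` to the fibres, as a change of summation
variable. -/
lemma sum_coarsenings_eq_sum_pi (hF : F.IsSubstitutive) (P : Part₀ F) {ι : Type*} [Fintype ι]
    [DecidableEq ι] {c : Fin P.deg → ι} {S : ι → Finset (Fin P.deg)} (hS : IsFibres c S)
    (hc : F.Mem (kernelPartition c)) (hP : P.part ≤ kernelPartition c)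
    [DecidablePred fun Q : Coarsening P => Q.1 ≤ kernelPartition c]
    {M : Type*} [AddCommMonoid M] (f : (∀ j, Coarsening (P.st (S j))) → M) :
    ∑ Q : Coarsening P with Q.1 ≤ kernelPartition c, f (fun j => Q.restr (S j)) =
      ∑ q, f q := by
  refine Finset.sum_bij (fun Q _ j => Q.restr (S j)) (fun _ _ => Finset.mem_univ _) ?_ ?_
    fun _ _ => rfl
  · intro Q hQ Q' hQ' h
    simp only [Finset.mem_filter, Finset.mem_univ, true_and] at hQ hQ'
    have h' : ∀ j, restrict Q.1 (S j) = restrict Q'.1 (S j) := fun j =>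
      congrArg Subtype.val (congrFun h j)
    exact Subtype.ext (le_antisymm (hS.le_of_restrict_le hQ fun j => (h' j).le)
      (hS.le_of_restrict_le hQ' fun j => (h' j).ge))
  · intro q _
    obtain ⟨Q, hQ, hQq⟩ := hS.exists_glue fun j => (q j).1
    have hle : P.part ≤ Q := hS.le_of_restrict_le hP fun j => by
      rw [hQq j]
      exact (q j).le
    have hmem : F.Mem Q := hF.mem_of_isFibres hS hc hQ fun j => by
      rw [hQq j]
      exact (q j).mem
    exact ⟨⟨Q, mem_coarsenings.2 ⟨hle, hmem⟩⟩, by simpa using hQ,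
      funext fun j => Subtype.ext (hQq j)⟩

/-! ### Fibre monomials and the refinement coproduct -/

section Fibre

variable (K : Type*) [CommSemiring K]

open Classical in
/-- The class of `P` in the free commutative algebra, the empty partition being sent to `1`. -/
noncomputable def blockClass (P : Part₀ F) : BBl K F :=
  if h : P.deg ≠ 0 then MvPolynomial.X ⟨P, h⟩ else 1

variable {K}

lemma blockClass_of_deg_ne_zero {P : Part₀ F} (h : P.deg ≠ 0) :
    blockClass K P = MvPolynomial.X ⟨P, h⟩ := dif_pos h

lemma blockClass_of_deg_eq_zero {P : Part₀ F} (h : P.deg = 0) : blockClass K P = 1 :=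
  dif_neg (not_not.2 h)

lemma blockClass_st_empty (P : Part₀ F) : blockClass K (P.st ∅) = 1 :=
  blockClass_of_deg_eq_zero (Finset.card_empty (α := Fin P.deg))

lemma fibreMonomial_eq_prod_subtype (P : Part₀ F) (Q : SetPartition P.deg) :
    fibreMonomial K P Q = ∏ τ : {τ // τ ∈ Q.parts}, blockClass K (P.st τ.1) :=
  Finset.prod_congr rfl fun τ _ => (blockClass_of_deg_ne_zero
    (Finset.card_ne_zero.2 (Q.nonempty_of_mem_parts τ.2))).symm

lemma fibreMonomial_eq_prod (P : Part₀ F) (Q : SetPartition P.deg) :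
    fibreMonomial K P Q = ∏ τ ∈ Q.parts, blockClass K (P.st τ) := by
  rw [fibreMonomial_eq_prod_subtype]
  exact Finset.prod_coe_sort Q.parts fun τ => blockClass K (P.st τ)

/-- The fibre monomial of `Q|_S`, as a product over the blocks of `Q` itself. -/
lemma fibreMonomial_st_restrict (P : Part₀ F) (Q : SetPartition P.deg) (S : Finset (Fin P.deg)) :
    fibreMonomial K (P.st S) (restrict Q S) = ∏ τ ∈ Q.parts, blockClass K (P.st (S ∩ τ)) := by
  refine (fibreMonomial_eq_prod (P.st S) (restrict Q S)).trans ?_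
  -- blocks that do not meet `S` contribute the factor `1`
  rw [← Finset.prod_filter_of_ne (p := fun τ => S ∩ τ ≠ ∅) (s := Q.parts)]
  · symm
    refine Finset.prod_bij (fun τ _ => standardizeSubset S τ) ?_ ?_ ?_ ?_
    · intro τ hτ
      obtain ⟨hτ, hne⟩ := Finset.mem_filter.1 hτ
      refine mem_parts_restrict.2 ⟨fun h => hne ?_, τ, hτ, rfl⟩
      rw [← unstandardize_standardizeSubset, h]
      rfl
    · intro τ hτ σ hσ h
      obtain ⟨hτ, hne⟩ := Finset.mem_filter.1 hτ
      obtain ⟨x, hx⟩ := Finset.nonempty_iff_ne_empty.2 hne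
      have hx' : x ∈ S ∩ σ := by
        rw [← unstandardize_standardizeSubset, ← h, unstandardize_standardizeSubset]
        exact hx
      exact Q.eq_of_mem_parts hτ (Finset.mem_filter.1 hσ).1 (Finset.mem_inter.1 hx).2
        (Finset.mem_inter.1 hx').2
    · intro τ' hτ'
      obtain ⟨hne, τ, hτ, rfl⟩ := mem_parts_restrict.1 hτ'
      refine ⟨τ, Finset.mem_filter.2 ⟨hτ, fun h => hne ?_⟩, rfl⟩
      rw [← standardizeSubset_unstandardize (standardizeSubset S τ),
        unstandardize_standardizeSubset, h]
      ext
      simp [mem_standardizeSubset]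
    · intro τ _
      exact congrArg (blockClass K) (P.st_st_standardizeSubset S τ).symm
  · intro τ _ h he
    exact h (by rw [he, blockClass_st_empty])

/-- A fibre monomial factors along every colouring that is constant on the blocks. -/
lemma fibreMonomial_eq_prod_of_isFibres (P : Part₀ F) {Q : SetPartition P.deg} {ι : Type*}
    [Fintype ι] {c : Fin P.deg → ι} {S : ι → Finset (Fin P.deg)} (hS : IsFibres c S)
    (hQ : Q ≤ kernelPartition c) :
    fibreMonomial K P Q = ∏ j, fibreMonomial K (P.st (S j)) (restrict Q (S j)) := by
  simp only [fibreMonomial_st_restrict]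
  rw [Finset.prod_comm, fibreMonomial_eq_prod]
  refine Finset.prod_congr rfl fun τ hτ => ?_
  obtain ⟨x, hx⟩ := Q.nonempty_of_mem_parts hτ
  have hc : ∀ y ∈ τ, c y = c x := fun y hy =>
    le_kernelPartition.1 hQ y x (sameBlock_of_mem hτ hy hx)
  rw [Finset.prod_eq_single (c x)]
  · rw [Finset.inter_eq_right.2 fun y hy => (hS y _).2 (hc y hy)]
  · intro j _ hj
    rw [Finset.disjoint_iff_inter_eq_empty.1, blockClass_st_empty]
    refine Finset.disjoint_left.2 fun y hy hyτ => hj ?_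
    rw [← (hS y j).1 hy, hc y hyτ]
  · intro h
    exact absurd (Finset.mem_univ _) h

lemma fibreMonomial_of_deg_eq_zero {P : Part₀ F} (h : P.deg = 0) (Q : SetPartition P.deg) :
    fibreMonomial K P Q = 1 := by
  have : IsEmpty (Fin P.deg) := by rw [h]; infer_instance
  have hparts : Q.parts = ∅ := Finset.eq_empty_of_forall_notMem fun b hb => by
    obtain ⟨i, -⟩ := Q.nonempty_of_mem_parts hb
    exact isEmptyElim i
  rw [fibreMonomial_eq_prod, hparts, Finset.prod_empty]

lemma refinementCoproduct_blockClass (P : Part₀ F) :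
    refinementCoproduct K F (blockClass K P) =
      ∑ Q : Coarsening P, blockClass K Q.toPart₀ ⊗ₜ[K] fibreMonomial K P Q.1 := by
  by_cases h : P.deg ≠ 0
  · rw [blockClass_of_deg_ne_zero h]
    refine (MvPolynomial.aeval_X _ _).trans ?_
    exact Finset.sum_congr rfl fun (Q : Coarsening P) _ => congrArg
      (· ⊗ₜ[K] fibreMonomial K P Q.1) (blockClass_of_deg_ne_zero (P := Q.toPart₀) h).symm
  · rw [not_not] at h
    rw [blockClass_of_deg_eq_zero h, map_one, sum_coarsenings_of_deg_eq_zero h,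
      blockClass_of_deg_eq_zero (P := Coarsening.toPart₀ _) h, fibreMonomial_of_deg_eq_zero h]
    rfl

lemma prod_tmul_prod {A B ι : Type*} [CommSemiring A] [Algebra K A] [CommSemiring B] [Algebra K B]
    (s : Finset ι) (f : ι → A) (g : ι → B) :
    ∏ i ∈ s, f i ⊗ₜ[K] g i = (∏ i ∈ s, f i) ⊗ₜ[K] ∏ i ∈ s, g i := by
  classical
  induction s using Finset.induction_on with
  | empty => rfl
  | insert i s hi ih => simp [Finset.prod_insert hi, ih]

open Classical in
/-- The coproduct of `P / R` runs through the partitions between `P` and `R`: choosing a coarsening of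
`P` on every block of `R` amounts to choosing one coarsening of `P` below `R`. -/
lemma refinementCoproduct_fibreMonomial (hF : F.IsSubstitutive) (P : Part₀ F) (R : Coarsening P) :
    refinementCoproduct K F (fibreMonomial K P R.1) =
      ∑ Q : Coarsening P with Q.1 ≤ R.1,
        fibreMonomial K Q.toPart₀ R.1 ⊗ₜ[K] fibreMonomial K P Q.1 := by
  let c : Fin P.deg → {τ // τ ∈ R.1.parts} := fun x => ⟨R.1.part x, part_mem_parts R.1 x⟩
  let S : {τ // τ ∈ R.1.parts} → Finset (Fin P.deg) := fun τ => τ.1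
  have hS : IsFibres c S := fun x τ => by
    rw [Subtype.ext_iff]
    exact (R.1.part_eq_iff_mem τ.2).symm
  have hker : kernelPartition c = R.1 := setPartition_ext fun i j =>
    sameBlock_kernelPartition.trans Subtype.ext_iff
  rw [fibreMonomial_eq_prod_subtype, map_prod]
  simp only [refinementCoproduct_blockClass]
  rw [Finset.prod_univ_sum, Fintype.piFinset_univ]
  have key := sum_coarsenings_eq_sum_pi hF P hS (hker.symm ▸ R.mem) (hker.symm ▸ R.le) (fun q => ∏ τ,
    blockClass K (q τ).toPart₀ ⊗ₜ[K] fibreMonomial K (P.st (S τ)) (q τ).1)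
  refine key.symm.trans (Finset.sum_congr (by simp only [hker]) fun Q hQ => ?_)
  have hQR : Q.1 ≤ R.1 := (Finset.mem_filter.1 hQ).2
  rw [prod_tmul_prod]
  exact congrArg₂ (· ⊗ₜ[K] ·) (fibreMonomial_eq_prod_subtype Q.toPart₀ R.1).symm
    (fibreMonomial_eq_prod_of_isFibres P hS (hker.symm ▸ hQR)).symm

/-- Coarsenings of a coarsening `Q` of `P` are the coarsenings of `P` above `Q`. -/
lemma sum_coarsenings_toPart₀ {M : Type*} [AddCommMonoid M] {P : Part₀ F} (Q : Coarsening P)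
    [DecidablePred fun R : Coarsening P => Q.1 ≤ R.1] (f : Part₀ F → SetPartition P.deg → M) :
    ∑ R : Coarsening Q.toPart₀, f R.toPart₀ R.1 =
      ∑ R : Coarsening P with Q.1 ≤ R.1, f R.toPart₀ R.1 := by
  symm
  refine Finset.sum_bij (fun R hR => ⟨R.1, mem_coarsenings.2 ⟨(Finset.mem_filter.1 hR).2, R.mem⟩⟩)
    (fun _ _ => Finset.mem_univ _) (fun R _ R' _ h => Subtype.ext (Subtype.mk.inj h)) ?_
    fun _ _ => rfl
  intro R _
  exact ⟨⟨R.1, mem_coarsenings.2 ⟨Q.le.trans R.le, R.mem⟩⟩,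
    Finset.mem_filter.2 ⟨Finset.mem_univ _, R.le⟩, rfl⟩

/-- Coassociativity of refinement, with the coarsest partition taken in an arbitrary module: this
covers the coproduct `δ` as well as the coaction `ρ`. -/
lemma sum_coarsenings_coassoc (hF : F.IsSubstitutive) {M : Type*} [AddCommMonoid M] [Module K M]
    (g : Part₀ F → M) (P : Part₀ F) :
    ∑ Q : Coarsening P, ∑ R : Coarsening Q.toPart₀,
        g R.toPart₀ ⊗ₜ[K] (fibreMonomial K Q.toPart₀ R.1 ⊗ₜ[K] fibreMonomial K P Q.1) =
      ∑ R : Coarsening P, g R.toPart₀ ⊗ₜ[K] refinementCoproduct K F (fibreMonomial K P R.1) := by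
  classical
  simp only [refinementCoproduct_fibreMonomial hF, TensorProduct.tmul_sum]
  rw [Finset.sum_congr rfl fun Q _ => sum_coarsenings_toPart₀ Q fun R' R =>
    g R' ⊗ₜ[K] (fibreMonomial K Q.toPart₀ R ⊗ₜ[K] fibreMonomial K P Q.1)]
  refine Finset.sum_comm' fun Q R => ?_
  simp

end Fibre

/-! ### The list of the gaps -/

section SplitOnP

variable {α : Type*} {p q : α → Bool}

/-- Splitting at more places amounts to splitting the pieces. -/
lemma splitOnP_eq_flatMap_splitOnP (h : ∀ a, p a → q a) (l : List α) :
    l.splitOnP q = (l.splitOnP p).flatMap (List.splitOnP q) := by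
  induction l with
  | nil => simp
  | cons a l ih =>
    rw [List.splitOnP_cons_eq_if_modifyHead, List.splitOnP_cons_eq_if_modifyHead (p := p), ih]
    by_cases hp : p a
    · simp [hp, h a hp]
    · obtain ⟨u, t, hut⟩ := List.exists_cons_of_ne_nil (List.splitOnP_ne_nil p l)
      rw [hut]
      by_cases hq : q a
      · simp [hp, hq, List.splitOnP_cons_eq_if_modifyHead]
      · obtain ⟨u', t', hut'⟩ := List.exists_cons_of_ne_nil (List.splitOnP_ne_nil q u)
        simp [hp, hq, List.splitOnP_cons_eq_if_modifyHead, hut']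

lemma sublist_of_mem_splitOnP {l s : List α} (hs : s ∈ l.splitOnP p) : s.Sublist l := by
  induction l generalizing s with
  | nil => simp_all
  | cons a l ih =>
    rw [List.splitOnP_cons_eq_if_modifyHead] at hs
    by_cases hp : p a
    · rw [if_pos hp, List.mem_cons] at hs
      rcases hs with rfl | hs
      · simp
      · exact (ih hs).cons a
    · obtain ⟨u, t, hut⟩ := List.exists_cons_of_ne_nil (List.splitOnP_ne_nil p l)
      rw [if_neg hp, hut, List.modifyHead_cons, List.mem_cons] at hs
      rcases hs with rfl | hs
      · exact (ih (hut ▸ List.mem_cons_self)).cons_cons a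
      · exact (ih (hut ▸ List.mem_cons_of_mem _ hs)).cons a

end SplitOnP

section GapList

variable {α : Type*} [LinearOrder α]

/-- The list of the gaps of `S ∩ X` inside `S`, from left to right and including the empty ones. -/
def gapList (S X : Finset α) : List (Finset α) :=
  (List.range ((S ∩ X).card + 1)).map fun i =>
    S.filter fun y => y ∉ X ∧ ((S ∩ X).filter (· < y)).card = i

lemma gapList_eq_map_splitOnP (S X : Finset α) :
    gapList S X = (S.sort.splitOnP (· ∈ X)).map List.toFinset := by
  induction S using Finset.induction_on_min with
  | empty => simp [gapList]
  | insert a S hmin ih =>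
    have haS : a ∉ S := fun h => lt_irrefl a (hmin a h)
    rw [Finset.sort_insert _ (fun b hb => (hmin b hb).le) haS,
      List.splitOnP_cons_eq_if_modifyHead]
    by_cases haX : a ∈ X
    · have hcap : insert a S ∩ X = insert a (S ∩ X) := Finset.insert_inter_of_mem haX
      have haSX : a ∉ S ∩ X := fun h => haS (Finset.mem_inter.1 h).1
      have hcard : ∀ y ∈ S, ((insert a S ∩ X).filter (· < y)).card =
          ((S ∩ X).filter (· < y)).card + 1 := fun y hy => by
        rw [hcap, Finset.filter_insert, if_pos (hmin y hy), Finset.card_insert_of_notMem]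
        exact fun h => haSX (Finset.mem_filter.1 h).1
      simp only [haX, decide_true, if_true, List.map_cons, ← ih]
      rw [gapList, gapList, hcap, Finset.card_insert_of_notMem haSX, List.range_succ_eq_map,
        List.map_cons, List.map_map]
      refine congrArg₂ List.cons ?_ (List.map_congr_left fun i _ => ?_)
      · rw [← hcap]
        refine Finset.filter_eq_empty_iff.2 fun y hy h => ?_
        rcases Finset.mem_insert.1 hy with rfl | hy
        · exact h.1 haX
        · rw [hcard y hy] at h
          exact Nat.succ_ne_zero _ h.2
      · rw [← hcap]
        ext y
        simp only [Function.comp_apply, Finset.mem_filter, Finset.mem_insert]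
        constructor
        · rintro ⟨rfl | hy, hyX, h⟩
          · exact absurd haX hyX
          · exact ⟨hy, hyX, Nat.succ_injective ((hcard y hy).symm.trans h)⟩
        · rintro ⟨hy, hyX, rfl⟩
          exact ⟨Or.inr hy, hyX, hcard y hy⟩
    · have hcap : insert a S ∩ X = S ∩ X := Finset.insert_inter_of_notMem haX
      have hzero : ((S ∩ X).filter (· < a)).card = 0 := by
        refine Finset.card_eq_zero.2 (Finset.filter_eq_empty_iff.2 fun y hy => ?_)
        exact (hmin y (Finset.mem_inter.1 hy).1).not_gt
      have hmod : (List.modifyHead (List.cons a) (S.sort.splitOnP (· ∈ X))).map List.toFinset =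
          List.modifyHead (insert a) ((S.sort.splitOnP (· ∈ X)).map List.toFinset) := by
        cases S.sort.splitOnP (· ∈ X) <;> simp
      simp only [haX, decide_false, Bool.false_eq_true, if_false]
      rw [hmod, ← ih, gapList, gapList, hcap, List.range_succ_eq_map, List.map_cons, List.map_cons,
        List.modifyHead_cons]
      refine congrArg₂ List.cons ?_ (List.map_congr_left fun i hi => ?_)
      · rw [Finset.filter_insert, if_pos ⟨haX, hzero⟩]
      · rw [Finset.filter_insert, if_neg]
        rintro ⟨-, h⟩
        obtain ⟨j, -, rfl⟩ := List.mem_map.1 hi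
        exact Nat.succ_ne_zero j (h.symm.trans hzero)

/-- The gaps of `X` are obtained by listing, for each gap `D` of the smaller set `Y`, the gaps of
`D ∩ X` in `D`. -/
lemma gapList_eq_flatMap {X Y : Finset α} (h : Y ⊆ X) (S : Finset α) :
    gapList S X = (gapList S Y).flatMap fun D => gapList D X := by
  rw [gapList_eq_map_splitOnP S X, gapList_eq_map_splitOnP S Y, List.flatMap_map,
    splitOnP_eq_flatMap_splitOnP (p := (· ∈ Y))
      (fun a ha => by simpa using h (by simpa using ha)), List.map_flatMap]
  refine List.flatMap_congr fun l hl => ?_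
  have hsub := sublist_of_mem_splitOnP hl
  rw [gapList_eq_map_splitOnP, (List.toFinset_sort (· ≤ ·) (hsub.nodup (S.sort_nodup _))).2
    ((S.pairwise_sort _).sublist hsub)]

end GapList

lemma gapList_univ {n : ℕ} (X : Finset (Fin n)) :
    gapList Finset.univ X = (List.range (X.card + 1)).map (gap X) := by
  simp only [gapList, Finset.univ_inter]
  rfl

/-- The gaps of a subset of `Fin S.card`, transported to `S`. -/
lemma map_unstandardize_gapList {n : ℕ} (S : Finset (Fin n)) (Z : Finset (Fin S.card)) :
    (gapList Finset.univ Z).map (unstandardize S) = gapList S (unstandardize S Z) := by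
  have hcap : S ∩ unstandardize S Z = unstandardize S Z :=
    Finset.inter_eq_right.2 (unstandardize_subset Z)
  rw [gapList, gapList, hcap, Finset.univ_inter, List.map_map, card_unstandardize]
  refine List.map_congr_left fun i _ => ?_
  have hcard : ∀ j, ((unstandardize S Z).filter (· < S.orderEmbOfFin rfl j)).card =
      (Z.filter (· < j)).card := fun j => by
    rw [unstandardize, Finset.filter_map, Finset.card_map]
    congr 1
    ext k
    simp
  ext x
  simp only [Function.comp_apply, mem_unstandardize, Finset.mem_filter, Finset.mem_univ, true_and]
  constructor
  · rintro ⟨j, ⟨hj, hi⟩, rfl⟩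
    refine ⟨S.orderEmbOfFin_mem rfl j, fun h => hj ?_, (hcard j).trans hi⟩
    exact mem_unstandardize_orderEmb.1 (mem_unstandardize.2 h)
  · rintro ⟨hx, hxZ, hi⟩
    obtain ⟨j, rfl⟩ := exists_orderEmbOfFin_eq hx
    refine ⟨j, ⟨fun h => hxZ ⟨j, h, rfl⟩, (hcard j).symm.trans hi⟩, rfl⟩

/-! ### Cuts -/

section Cuts

variable {n : ℕ} {P : SetPartition n} {X Y : Finset (Fin n)}

open Classical in
/-- The underlying sets of the lowersets of `P`. -/
noncomputable def cuts (P : SetPartition n) : Finset (Finset (Fin n)) :=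
  Finset.univ.filter (IsCut P)

lemma mem_cuts : X ∈ cuts P ↔ IsCut P X := by simp [cuts]

lemma IsCut.mono {Q : SetPartition n} (h : P ≤ Q) (hQ : IsCut Q X) : IsCut P X :=
  fun x y hxy => hQ x y (le_iff_sameBlock.1 h x y hxy)

lemma IsCut.mem_of_sameBlock (h : IsCut P X) {x y : Fin n} (hxy : SameBlock P x y) (hx : x ∈ X) :
    y ∈ X := by
  rcases le_total x y with hle | hle
  · exact (h x y hxy x hx le_rfl hle).2
  · exact (h y x hxy.symm x hx hle le_rfl).1

lemma mem_support {L : Finset (Finset (Fin n))} {x : Fin n} :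
    x ∈ support L ↔ ∃ b ∈ L, x ∈ b := by
  simp [support]

/-- A set of blocks is a lowerset exactly when its underlying set is a cut; only the generating
relation `⟶` of the preorder matters. -/
lemma mem_lowersets {L : Finset (Finset (Fin n))} :
    L ∈ lowersets P ↔ L ⊆ P.parts ∧ IsCut P (support L) := by
  simp only [lowersets, Finset.mem_filter, Finset.mem_powerset]
  refine and_congr_right fun hL => ⟨fun h x y hxy z hz hxz hzy => ?_, fun h π hπ σ hσπ => ?_⟩
  · obtain ⟨π, hπ, hzπ⟩ := mem_support.1 hz
    have hσ : P.part x ∈ L := h π hπ _ (Relation.TransGen.single ⟨part_mem_parts P x, hL hπ, z, hzπ,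
      x, mem_part_self P x, y, mem_part_iff.2 hxy, hxz, hzy⟩)
    exact ⟨mem_support.2 ⟨_, hσ, mem_part_self P x⟩, mem_support.2 ⟨_, hσ, mem_part_iff.2 hxy⟩⟩
  · induction hσπ using Relation.TransGen.head_induction_on with
    | single hστ =>
      obtain ⟨hσ, -, z, hz, a, ha, b, hb, haz, hzb⟩ := hστ
      obtain ⟨τ, hτ, haτ⟩ := mem_support.1 (h a b (sameBlock_of_mem hσ ha hb) z
        (mem_support.2 ⟨π, hπ, hz⟩) haz hzb).1
      rwa [P.eq_of_mem_parts hσ (hL hτ) ha haτ]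
    | head hστ _ ih =>
      obtain ⟨hσ, -, z, hz, a, ha, b, hb, haz, hzb⟩ := hστ
      obtain ⟨τ, hτ, haτ⟩ := mem_support.1 (h a b (sameBlock_of_mem hσ ha hb) z
        (mem_support.2 ⟨_, ih, hz⟩) haz hzb).1
      rwa [P.eq_of_mem_parts hσ (hL hτ) ha haτ]

/-- A lowerset is determined by its underlying set. -/
lemma sum_lowersets {M : Type*} [AddCommMonoid M] (P : SetPartition n)
    (f : Finset (Fin n) → M) : ∑ L ∈ lowersets P, f (support L) = ∑ X ∈ cuts P, f X := by
  refine Finset.sum_bij (fun L _ => support L) (fun L hL => mem_cuts.2 (mem_lowersets.1 hL).2)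
    ?_ ?_ fun _ _ => rfl
  · have key : ∀ L ∈ lowersets P, ∀ L' ∈ lowersets P, support L = support L' → L ⊆ L' := by
      intro L hL L' hL' h b hb
      obtain ⟨x, hx⟩ := P.nonempty_of_mem_parts ((mem_lowersets.1 hL).1 hb)
      have hx' : x ∈ support L' := h ▸ mem_support.2 ⟨b, hb, hx⟩
      obtain ⟨c, hc, hxc⟩ := mem_support.1 hx'
      rwa [P.eq_of_mem_parts ((mem_lowersets.1 hL).1 hb) ((mem_lowersets.1 hL').1 hc) hx hxc]
    exact fun L hL L' hL' h => (key L hL L' hL' h).antisymm (key L' hL' L hL h.symm)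
  · intro X hX
    have hX := mem_cuts.1 hX
    have hsupp : support (P.parts.filter (· ⊆ X)) = X := by
      ext x
      rw [mem_support]
      constructor
      · rintro ⟨b, hb, hx⟩
        exact (Finset.mem_filter.1 hb).2 hx
      · intro hx
        exact ⟨P.part x, Finset.mem_filter.2 ⟨part_mem_parts P x, fun y hy =>
          hX.mem_of_sameBlock (mem_part_iff.1 hy) hx⟩, mem_part_self P x⟩
    exact ⟨_, mem_lowersets.2 ⟨Finset.filter_subset _ _, by rwa [hsupp]⟩, hsupp⟩

lemma IsCut.restrict (h : IsCut P X) (S : Finset (Fin n)) :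
    IsCut (restrict P S) (standardizeSubset S X) := by
  intro x y hxy z hz hxz hzy
  simp only [mem_standardizeSubset] at hz ⊢
  exact h _ _ (sameBlock_restrict.1 hxy) _ hz (by simpa using hxz) (by simpa using hzy)

lemma isCut_restrict_iff (h : IsCut P X) {Z : Finset (Fin X.card)} :
    IsCut (PartitionBialgebra.restrict P X) Z ↔ IsCut P (unstandardize X Z) := by
  constructor
  · intro hZ x y hxy z hz hxz hzy
    obtain ⟨hx, hy⟩ := h x y hxy z (unstandardize_subset Z hz) hxz hzy
    obtain ⟨x, rfl⟩ := exists_orderEmbOfFin_eq hx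
    obtain ⟨y, rfl⟩ := exists_orderEmbOfFin_eq hy
    obtain ⟨z, hzZ, rfl⟩ := mem_unstandardize.1 hz
    simp only [mem_unstandardize_orderEmb]
    exact hZ x y (sameBlock_restrict.2 hxy) z hzZ (by simpa using hxz) (by simpa using hzy)
  · intro hZ
    have := hZ.restrict X
    rwa [standardizeSubset_unstandardize] at this

/-- Cuts of `P|_X` are the cuts of `P` inside `X`. -/
lemma sum_cuts_restrict {M : Type*} [AddCommMonoid M] (hX : IsCut P X)
    (f : Finset (Fin n) → M) :
    ∑ Z ∈ cuts (restrict P X), f (unstandardize X Z) = ∑ Y ∈ cuts P with Y ⊆ X, f Y := by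
  refine Finset.sum_bij (fun Z _ => unstandardize X Z) ?_ ?_ ?_ fun _ _ => rfl
  · intro Z hZ
    exact Finset.mem_filter.2 ⟨mem_cuts.2 ((isCut_restrict_iff hX).1 (mem_cuts.1 hZ)),
      unstandardize_subset Z⟩
  · intro Z _ Z' _ h
    rw [← standardizeSubset_unstandardize Z, h, standardizeSubset_unstandardize]
  · intro Y hY
    obtain ⟨hY, hYX⟩ := Finset.mem_filter.1 hY
    exact ⟨standardizeSubset X Y, mem_cuts.2 ((mem_cuts.1 hY).restrict X), by
      rw [unstandardize_standardizeSubset, Finset.inter_eq_right.2 hYX]⟩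

lemma exists_mem_gap {x : Fin n} (hx : x ∉ Y) : ∃ i : Fin (Y.card + 1), x ∈ gap Y i :=
  ⟨⟨(Y.filter (· < x)).card, Nat.lt_succ_of_le (Finset.card_filter_le _ _)⟩,
    mem_gap.2 ⟨hx, rfl⟩⟩

/-- A set that contains the cut `Y` and induces a cut on every gap of `Y` is a cut. -/
lemma isCut_of_restrict_gap (hY : IsCut P Y) (hYX : Y ⊆ X)
    (h : ∀ i : Fin (Y.card + 1), IsCut (restrict P (gap Y i)) (standardizeSubset (gap Y i) X)) :
    IsCut P X := by
  intro x y hxy z hz hxz hzy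
  by_cases hx : x ∈ Y
  · exact ⟨hYX hx, hYX (hY.mem_of_sameBlock hxy hx)⟩
  · have hy : y ∉ Y := fun hy => hx (hY.mem_of_sameBlock hxy.symm hy)
    have hcol := le_kernelPartition.1 (isCut_iff_le.1 hY) x y hxy
    have hno := (gapColor_eq_iff (hxz.trans hzy) hx).1 hcol
    have hcolz : gapColor Y x = gapColor Y z := (gapColor_eq_iff hxz hx).2
      fun w hw hxw hwz => hno w hw hxw (hwz.trans hzy)
    obtain ⟨i, hi⟩ := exists_mem_gap hx
    have hxi : gapColor Y x = some i := (isFibres_gap Y x (some i)).1 hi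
    have hyi : y ∈ gap Y i := (isFibres_gap Y y (some i)).2 (hcol.symm.trans hxi)
    have hzi : z ∈ gap Y i := (isFibres_gap Y z (some i)).2 (hcolz.symm.trans hxi)
    obtain ⟨x, rfl⟩ := exists_orderEmbOfFin_eq hi
    obtain ⟨y, rfl⟩ := exists_orderEmbOfFin_eq hyi
    obtain ⟨z, rfl⟩ := exists_orderEmbOfFin_eq hzi
    simpa only [mem_standardizeSubset] using h i x y (sameBlock_restrict.2 hxy) z
      (mem_standardizeSubset.2 hz) (by simpa using hxz) (by simpa using hzy)

/-- The cuts of `P` that contain the cut `Y` are the families of cuts of the restrictions of `P` to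
the gaps of `Y`. -/
lemma sum_cuts_superset {M : Type*} [AddCommMonoid M] (hY : IsCut P Y)
    (f : (∀ i : Fin (Y.card + 1), Finset (Fin (gap Y i).card)) → M) :
    ∑ X ∈ cuts P with Y ⊆ X, f (fun i => standardizeSubset (gap Y i) X) =
      ∑ q ∈ Fintype.piFinset fun i : Fin (Y.card + 1) => cuts (restrict P (gap Y i)), f q := by
  refine Finset.sum_bij (fun X _ i => standardizeSubset (gap Y i) X) ?_ ?_ ?_ fun _ _ => rfl
  · intro X hX
    exact Fintype.mem_piFinset.2 fun i =>
      mem_cuts.2 ((mem_cuts.1 (Finset.mem_filter.1 hX).1).restrict _)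
  · have key : ∀ X X' : Finset (Fin n), Y ⊆ X' →
        (∀ i : Fin (Y.card + 1),
          standardizeSubset (gap Y i) X = standardizeSubset (gap Y i) X') → X ⊆ X' := by
      intro X X' hX' h x hx
      by_cases hxY : x ∈ Y
      · exact hX' hxY
      · obtain ⟨i, hi⟩ := exists_mem_gap hxY
        obtain ⟨a, rfl⟩ := exists_orderEmbOfFin_eq hi
        rw [← mem_standardizeSubset, ← h i, mem_standardizeSubset]
        exact hx
    intro X hX X' hX' h
    exact (key X X' (Finset.mem_filter.1 hX').2 fun i => congrFun h i).antisymm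
      (key X' X (Finset.mem_filter.1 hX).2 fun i => (congrFun h i).symm)
  · intro q hq
    let X : Finset (Fin n) := Y ∪ Finset.univ.biUnion fun i : Fin (Y.card + 1) =>
      unstandardize (gap Y i) (q i)
    have hX : ∀ i : Fin (Y.card + 1), standardizeSubset (gap Y i) X = q i := by
      intro i
      ext a
      have ha : (gap Y i).orderEmbOfFin rfl a ∈ gap Y i := Finset.orderEmbOfFin_mem _ rfl a
      rw [mem_standardizeSubset, Finset.mem_union, Finset.mem_biUnion]
      constructor
      · rintro (h | ⟨j, -, h⟩)
        · exact absurd h (mem_gap.1 ha).1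
        · obtain rfl : j = i := Fin.ext
            ((mem_gap.1 (unstandardize_subset _ h)).2.symm.trans (mem_gap.1 ha).2)
          exact mem_unstandardize_orderEmb.1 h
      · exact fun h => Or.inr ⟨i, Finset.mem_univ i, mem_unstandardize_orderEmb.2 h⟩
    have hYX : Y ⊆ X := Finset.subset_union_left
    refine ⟨X, Finset.mem_filter.2 ⟨mem_cuts.2 (isCut_of_restrict_gap hY hYX fun i => ?_), hYX⟩,
      funext hX⟩
    rw [hX i]
    exact mem_cuts.1 (Fintype.mem_piFinset.1 hq i)

end Cuts

/-! ### Products over gaps -/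

section Products

/-- Distributivity for ordered products in a noncommutative algebra. -/
lemma prod_ofFn_sum (K : Type*) [CommSemiring K] {A : Type*} [Semiring A] [Algebra K A] {m : ℕ}
    {α : Fin m → Type*} (s : ∀ i, Finset (α i)) (g : ∀ i, α i → A) :
    (List.ofFn fun i => ∑ a ∈ s i, g i a).prod =
      ∑ r ∈ Fintype.piFinset s, (List.ofFn fun i => g i (r i)).prod := by
  simpa using (MultilinearMap.mkPiAlgebraFin K m A).map_sum_finset g s

lemma prod_ofFn_tmul (K : Type*) [CommSemiring K] {A B : Type*} [Semiring A] [Algebra K A]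
    [Semiring B] [Algebra K B] {m : ℕ} (f : Fin m → A) (g : Fin m → B) :
    (List.ofFn fun i => f i ⊗ₜ[K] g i).prod = (List.ofFn f).prod ⊗ₜ[K] (List.ofFn g).prod := by
  induction m with
  | zero => simp [Algebra.TensorProduct.one_def]
  | succ m ih => simp [List.ofFn_succ, ih]

variable (K : Type*) [CommSemiring K]

/-- The product of the restrictions of `P` to the gaps of `S ∩ X` inside `S`. -/
noncomputable def gapProduct (P : Part₀ F) (S X : Finset (Fin P.deg)) : BGap K F :=
  ((gapList S X).map fun D => FreeAlgebra.ι K (P.st D)).prod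

variable {K}

lemma map_range_eq_ofFn {α : Type*} (f : ℕ → α) (m : ℕ) :
    (List.range m).map f = List.ofFn fun i : Fin m => f i := by
  refine List.ext_getElem (by simp) fun i h₁ h₂ => by simp

lemma gapProduct_univ (P : Part₀ F) (X : Finset (Fin P.deg)) :
    gapProduct K P Finset.univ X =
      (List.ofFn fun i : Fin (X.card + 1) => FreeAlgebra.ι K (P.st (gap X i))).prod := by
  rw [gapProduct, gapList_univ, List.map_map, map_range_eq_ofFn]
  rfl

lemma gapMonomial_eq_gapProduct (P : Part₀ F) (L : Finset (Finset (Fin P.deg))) :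
    gapMonomial K P L = gapProduct K P Finset.univ (support L) :=
  (gapProduct_univ P _).symm

lemma gapProduct_st (P : Part₀ F) (S : Finset (Fin P.deg)) (Z : Finset (Fin S.card)) :
    gapProduct K (P.st S) Finset.univ Z = gapProduct K P S (unstandardize S Z) := by
  rw [gapProduct.eq_def K P, ← map_unstandardize_gapList, List.map_map]
  exact congrArg List.prod (List.map_congr_left fun D _ =>
    congrArg (FreeAlgebra.ι K) (P.st_st S D))

lemma gapProduct_st_standardizeSubset (P : Part₀ F) (S X : Finset (Fin P.deg)) :
    gapProduct K (P.st S) Finset.univ (standardizeSubset S X) = gapProduct K P S X := by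
  refine (gapProduct_st P S _).trans ?_
  rw [unstandardize_standardizeSubset, gapProduct, gapProduct]
  congr 2
  rw [gapList, gapList, ← Finset.inter_assoc, Finset.inter_self]
  refine List.map_congr_left fun i _ => Finset.filter_congr fun y hy => ?_
  simp [hy]

/-- As `X` misses no element of `Y`, there are as many gaps of `Y` in `X` as in the whole set. -/
lemma gapProduct_of_subset (P : Part₀ F) {X Y : Finset (Fin P.deg)} (h : Y ⊆ X) :
    gapProduct K P X Y =
      (List.ofFn fun i : Fin (Y.card + 1) => FreeAlgebra.ι K (P.st (gap Y i ∩ X))).prod := by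
  rw [gapProduct, gapList, Finset.inter_eq_right.2 h, List.map_map, map_range_eq_ofFn]
  refine congrArg (fun g => (List.ofFn g).prod) (funext fun i => ?_)
  refine congrArg (fun D => FreeAlgebra.ι K (P.st D)) (Finset.ext fun y => ?_)
  simp [mem_gap, and_comm]

/-- The gaps of `X`, grouped according to the gaps of a smaller set `Y`. -/
lemma gapProduct_univ_of_subset (P : Part₀ F) {X Y : Finset (Fin P.deg)} (h : Y ⊆ X) :
    gapProduct K P Finset.univ X =
      (List.ofFn fun i : Fin (Y.card + 1) => gapProduct K P (gap Y i) X).prod := by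
  rw [gapProduct, gapList_eq_flatMap h, gapList_univ, List.flatMap_map, List.map_flatMap,
    List.flatMap_def, List.prod_flatten, List.map_map, map_range_eq_ofFn]
  rfl

lemma cutCoproduct_ι (P : Part₀ F) :
    cutCoproduct K F (FreeAlgebra.ι K P) =
      ∑ X ∈ cuts P.part, FreeAlgebra.ι K (P.st X) ⊗ₜ[K] gapProduct K P Finset.univ X := by
  rw [cutCoproduct, FreeAlgebra.lift_ι_apply, ← sum_lowersets]
  simp only [gapMonomial_eq_gapProduct]

/-- The cut coproduct of the restriction to a cut. -/
lemma cutCoproduct_ι_st (P : Part₀ F) {X : Finset (Fin P.deg)} (hX : IsCut P.part X) :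
    cutCoproduct K F (FreeAlgebra.ι K (P.st X)) =
      ∑ Y ∈ cuts P.part with Y ⊆ X, FreeAlgebra.ι K (P.st Y) ⊗ₜ[K] gapProduct K P X Y := by
  rw [cutCoproduct_ι, ← sum_cuts_restrict hX]
  exact Finset.sum_congr rfl fun Z _ => congrArg₂ (· ⊗ₜ[K] ·)
    (congrArg (FreeAlgebra.ι K) (P.st_st X Z)) (gapProduct_st P X Z)

/-- The cut coproduct of a product over the gaps of a cut. -/
lemma cutCoproduct_gapProduct (P : Part₀ F) {Y : Finset (Fin P.deg)} (hY : IsCut P.part Y) :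
    cutCoproduct K F (gapProduct K P Finset.univ Y) =
      ∑ X ∈ cuts P.part with Y ⊆ X, gapProduct K P X Y ⊗ₜ[K] gapProduct K P Finset.univ X := by
  rw [gapProduct_univ, map_list_prod, List.map_ofFn]
  simp only [Function.comp_def, cutCoproduct_ι]
  refine (prod_ofFn_sum K (fun i : Fin (Y.card + 1) => cuts (restrict P.part (gap Y i)))
    fun i Z => FreeAlgebra.ι K ((P.st (gap Y i)).st Z) ⊗ₜ[K]
      gapProduct K (P.st (gap Y i)) Finset.univ Z).trans ?_
  refine (sum_cuts_superset hY _).symm.trans (Finset.sum_congr rfl fun X hX => ?_)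
  have hYX := (Finset.mem_filter.1 hX).2
  rw [prod_ofFn_tmul, gapProduct_of_subset P hYX, gapProduct_univ_of_subset P hYX]
  refine congrArg₂ (· ⊗ₜ[K] ·) (congrArg (fun g => (List.ofFn g).prod) (funext fun i => ?_))
    (congrArg (fun g => (List.ofFn g).prod) (funext fun i => ?_))
  · exact congrArg (FreeAlgebra.ι K) (P.st_st_standardizeSubset _ _)
  · exact gapProduct_st_standardizeSubset P _ X

/-- Coassociativity of the cut coproduct, on generators: both sides run over the pairs of nested
cuts. -/
lemma sum_cuts_coassoc (P : Part₀ F) :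
    ∑ X ∈ cuts P.part, ∑ Y ∈ cuts P.part with Y ⊆ X,
        FreeAlgebra.ι K (P.st Y) ⊗ₜ[K]
          (gapProduct K P X Y ⊗ₜ[K] gapProduct K P Finset.univ X) =
      ∑ Y ∈ cuts P.part, FreeAlgebra.ι K (P.st Y) ⊗ₜ[K]
        cutCoproduct K F (gapProduct K P Finset.univ Y) := by
  refine (Finset.sum_comm' fun X Y => ?_).trans (Finset.sum_congr rfl fun Y hY => by
    rw [cutCoproduct_gapProduct P (mem_cuts.1 hY), TensorProduct.tmul_sum])
  simp only [Finset.mem_filter]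
  tauto

end Products

/-! ### The gap-insertion bialgebra -/

variable {K : Type*} [CommSemiring K]

lemma gapCounit_ι (P : Part₀ F) :
    gapCounit K F (FreeAlgebra.ι K P) = if P.deg = 0 then 1 else 0 :=
  FreeAlgebra.lift_ι_apply _ _

lemma gapCounit_gapProduct (P : Part₀ F) (X : Finset (Fin P.deg)) :
    gapCounit K F (gapProduct K P Finset.univ X) = if X = Finset.univ then 1 else 0 := by
  rw [gapProduct_univ, map_list_prod, List.map_ofFn]
  have hval : ∀ i : Fin (X.card + 1),
      (gapCounit K F ∘ fun i : Fin (X.card + 1) => FreeAlgebra.ι K (P.st (gap X i))) i =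
        if gap X i = ∅ then 1 else 0 := fun i =>
    (gapCounit_ι _).trans (if_congr Part₀.deg_st_eq_zero_iff rfl rfl)
  rw [List.prod_ofFn]
  simp only [hval]
  split_ifs with hX
  · refine Finset.prod_eq_one fun i _ => if_pos (Finset.eq_empty_of_forall_notMem fun x hx => ?_)
    exact (mem_gap.1 hx).1 (hX ▸ Finset.mem_univ x)
  · obtain ⟨x, hx⟩ : ∃ x, x ∉ X := by
      by_contra! h
      exact hX (Finset.eq_univ_of_forall h)
    obtain ⟨i, hi⟩ := exists_mem_gap hx
    exact Finset.prod_eq_zero (Finset.mem_univ i) (if_neg (Finset.ne_empty_of_mem hi))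

lemma gapProduct_univ_empty (P : Part₀ F) :
    gapProduct K P Finset.univ ∅ = FreeAlgebra.ι K P := by
  have h : gap (∅ : Finset (Fin P.deg)) 0 = Finset.univ := by
    ext
    simp [mem_gap]
  rw [gapProduct, gapList_univ]
  simp [h, P.st_univ]

lemma isBialgebra_gap : IsBialgebra K (cutCoproduct K F).toLinearMap
    (gapCounit K F).toLinearMap where
  coassoc := by
    have h : (Algebra.TensorProduct.assoc K K K (BGap K F) (BGap K F) (BGap K F)).toAlgHom.comp
        ((Algebra.TensorProduct.map (cutCoproduct K F) (.id K _)).comp (cutCoproduct K F)) =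
        (Algebra.TensorProduct.map (.id K _) (cutCoproduct K F)).comp (cutCoproduct K F) := by
      refine FreeAlgebra.hom_ext (funext fun P => ?_)
      simp only [Function.comp_apply, AlgHom.comp_apply, cutCoproduct_ι P, map_sum,
        Algebra.TensorProduct.map_tmul, AlgHom.id_apply]
      rw [← sum_cuts_coassoc]
      refine Finset.sum_congr rfl fun X hX => ?_
      rw [cutCoproduct_ι_st P (mem_cuts.1 hX), TensorProduct.sum_tmul, map_sum]
      rfl
    exact congrArg AlgHom.toLinearMap h
  counit_left := by
    have h : (Algebra.TensorProduct.map (gapCounit K F) (.id K _)).comp (cutCoproduct K F) =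
        Algebra.TensorProduct.includeRight := by
      refine FreeAlgebra.hom_ext (funext fun P => ?_)
      simp only [Function.comp_apply, AlgHom.comp_apply, cutCoproduct_ι P, map_sum,
        Algebra.TensorProduct.map_tmul, AlgHom.id_apply, Algebra.TensorProduct.includeRight_apply]
      rw [Finset.sum_eq_single_of_mem ∅ (mem_cuts.2 fun x y _ z hz => absurd hz (by simp)),
        gapProduct_univ_empty, gapCounit_ι, if_pos (Part₀.deg_st_eq_zero_iff.2 rfl)]
      intro X _ hX
      rw [gapCounit_ι, if_neg fun h => hX (Part₀.deg_st_eq_zero_iff.1 h), TensorProduct.zero_tmul]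
    exact congrArg AlgHom.toLinearMap h
  counit_right := by
    have h : (Algebra.TensorProduct.map (.id K _) (gapCounit K F)).comp (cutCoproduct K F) =
        Algebra.TensorProduct.includeLeft := by
      refine FreeAlgebra.hom_ext (funext fun P => ?_)
      simp only [Function.comp_apply, AlgHom.comp_apply, cutCoproduct_ι P, map_sum,
        Algebra.TensorProduct.map_tmul, AlgHom.id_apply, Algebra.TensorProduct.includeLeft_apply]
      rw [Finset.sum_eq_single_of_mem Finset.univ
        (mem_cuts.2 fun x y _ _ _ _ _ => ⟨Finset.mem_univ x, Finset.mem_univ y⟩),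
        gapCounit_gapProduct, if_pos rfl, P.st_univ]
      intro X _ hX
      rw [gapCounit_gapProduct, if_neg hX, TensorProduct.tmul_zero]
    exact congrArg AlgHom.toLinearMap h
  comul_one := map_one (cutCoproduct K F)
  comul_mul := map_mul (cutCoproduct K F)
  counit_one := map_one (gapCounit K F)
  counit_mul := map_mul (gapCounit K F)

/-! ### The block-substitution bialgebra -/

open Classical in
lemma blockCounit_blockClass {P : Part₀ F} (h : P.deg ≠ 0) :
    blockCounit K F (blockClass K P) = if P.part.parts.card = 1 then 1 else 0 := by
  rw [blockClass_of_deg_ne_zero h]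
  refine (MvPolynomial.aeval_X _ _).trans ?_
  congr

open Classical in
/-- The counit detects the trivial coarsening: all restrictions of `P` to the blocks of `Q` have a
single block only if `Q = P`. -/
lemma blockCounit_fibreMonomial {P : Part₀ F} (Q : Coarsening P) :
    blockCounit K F (fibreMonomial K P Q.1) = if Q = Coarsening.refl P then 1 else 0 := by
  have hval : ∀ τ ∈ Q.1.parts, blockCounit K F (blockClass K (P.st τ)) =
      if (restrict P.part τ).parts.card = 1 then 1 else 0 := fun τ hτ =>
    blockCounit_blockClass (P := P.st τ) (Finset.card_ne_zero.2 (Q.1.nonempty_of_mem_parts hτ))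
  rw [fibreMonomial_eq_prod, map_prod, Finset.prod_congr rfl hval]
  split_ifs with h
  · subst h
    refine Finset.prod_eq_one fun τ hτ => if_pos (card_parts_eq_one_iff.2 ⟨?_, fun i j => ?_⟩)
    · exact Finset.card_ne_zero.2 (Finpartition.nonempty_of_mem_parts _ hτ)
    · exact sameBlock_restrict.2 (sameBlock_of_mem hτ (τ.orderEmbOfFin_mem rfl i)
        (τ.orderEmbOfFin_mem rfl j))
  · obtain ⟨x, y, hQ, hP⟩ : ∃ x y, SameBlock Q.1 x y ∧ ¬ SameBlock P.part x y := by
      by_contra! hall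
      exact h (Subtype.ext (le_antisymm (le_iff_sameBlock.2 hall) Q.le))
    obtain ⟨τ, hτ, hx, hy⟩ := sameBlock_iff_exists.1 hQ
    obtain ⟨i, rfl⟩ := exists_orderEmbOfFin_eq hx
    obtain ⟨j, rfl⟩ := exists_orderEmbOfFin_eq hy
    refine Finset.prod_eq_zero hτ (if_neg fun hcard => hP ?_)
    exact sameBlock_restrict.1 ((card_parts_eq_one_iff.1 hcard).2 i j)

/-- Right counitality of refinement, with the coarser partition taken in an arbitrary module: this
covers the coproduct `δ` as well as the coaction `ρ`. -/
lemma sum_coarsenings_counit {M : Type*} [AddCommMonoid M] [Module K M] (g : Part₀ F → M)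
    (P : Part₀ F) :
    ∑ Q : Coarsening P, g Q.toPart₀ ⊗ₜ[K] blockCounit K F (fibreMonomial K P Q.1) =
      g P ⊗ₜ[K] 1 := by
  classical
  rw [Finset.sum_eq_single_of_mem (Coarsening.refl P) (Finset.mem_univ _),
    blockCounit_fibreMonomial, if_pos rfl]
  · rfl
  · intro Q _ hQ
    rw [blockCounit_fibreMonomial, if_neg hQ, TensorProduct.tmul_zero]

lemma fibreMonomial_of_card_eq_one (P : Part₀ F) {Q : SetPartition P.deg} (h : Q.parts.card = 1) :
    fibreMonomial K P Q = blockClass K P := by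
  obtain ⟨b, hb⟩ := Finset.card_eq_one.1 h
  have huniv : b = Finset.univ := by
    have := Q.biUnion_parts
    rwa [hb, Finset.singleton_biUnion] at this
  rw [fibreMonomial_eq_prod, hb, Finset.prod_singleton, huniv, P.st_univ]

/-- The partition with a single block, as a coarsening of a non-empty partition. -/
lemma exists_unique_coarsening_card_eq_one (hF : F.IsSubstitutive) {P : Part₀ F} (h : P.deg ≠ 0) :
    ∃! Q : Coarsening P, Q.1.parts.card = 1 := by
  have hall : ∀ i j,
      SameBlock (kernelPartition (gapColor (Finset.univ : Finset (Fin P.deg)))) i j :=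
    fun i j => sameBlock_kernelPartition.2 (by simp [gapColor])
  refine ⟨⟨kernelPartition (gapColor Finset.univ), mem_coarsenings.2
    ⟨le_iff_sameBlock.2 fun i j _ => hall i j, hF.mem_gaps _⟩⟩,
    card_parts_eq_one_iff.2 ⟨h, hall⟩, fun Q hQ => Subtype.ext (setPartition_ext fun i j => ?_)⟩
  exact iff_of_true ((card_parts_eq_one_iff.1 hQ).2 i j) (hall i j)

/-- Left counitality of refinement: only the coarsening with a single block contributes. -/
lemma sum_blockCounit_tmul_fibreMonomial (hF : F.IsSubstitutive) {P : Part₀ F} (h : P.deg ≠ 0) :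
    ∑ Q : Coarsening P, blockCounit K F (blockClass K Q.toPart₀) ⊗ₜ[K] fibreMonomial K P Q.1 =
      1 ⊗ₜ[K] blockClass K P := by
  obtain ⟨Q, hQ, huniq⟩ := exists_unique_coarsening_card_eq_one hF h
  rw [Finset.sum_eq_single_of_mem Q (Finset.mem_univ _),
    blockCounit_blockClass (P := Q.toPart₀) h,
    if_pos (show Q.toPart₀.part.parts.card = 1 from hQ), fibreMonomial_of_card_eq_one P hQ]
  intro Q' _ hne
  rw [blockCounit_blockClass (P := Q'.toPart₀) h, 
    if_neg (show Q'.toPart₀.part.parts.card ≠ 1 from fun h' => hne (huniq Q' h')),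
    TensorProduct.zero_tmul]

lemma bBl_algHom_ext {A : Type*} [Semiring A] [Algebra K A] {f g : BBl K F →ₐ[K] A}
    (h : ∀ P : Part₀ F, P.deg ≠ 0 → f (blockClass K P) = g (blockClass K P)) : f = g := by
  refine MvPolynomial.algHom_ext fun P => ?_
  have := h P.1 P.2
  rwa [blockClass_of_deg_ne_zero P.2] at this

lemma isBialgebra_block (hF : F.IsSubstitutive) : IsBialgebra K
    (refinementCoproduct K F).toLinearMap (blockCounit K F).toLinearMap where
  coassoc := by
    have h : (Algebra.TensorProduct.assoc K K K (BBl K F) (BBl K F) (BBl K F)).toAlgHom.comp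
        ((Algebra.TensorProduct.map (refinementCoproduct K F) (.id K _)).comp
          (refinementCoproduct K F)) =
        (Algebra.TensorProduct.map (.id K _) (refinementCoproduct K F)).comp
          (refinementCoproduct K F) := by
      refine bBl_algHom_ext fun P _ => ?_
      simp only [AlgHom.comp_apply, refinementCoproduct_blockClass, map_sum,
        Algebra.TensorProduct.map_tmul, AlgHom.id_apply, TensorProduct.sum_tmul]
      exact sum_coarsenings_coassoc hF (blockClass K) P
    exact congrArg AlgHom.toLinearMap h
  counit_left := by
    have h : (Algebra.TensorProduct.map (blockCounit K F) (.id K _)).comp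
        (refinementCoproduct K F) = Algebra.TensorProduct.includeRight := by
      refine bBl_algHom_ext fun P hP => ?_
      simp only [AlgHom.comp_apply, refinementCoproduct_blockClass, map_sum,
        Algebra.TensorProduct.map_tmul, AlgHom.id_apply, Algebra.TensorProduct.includeRight_apply]
      exact sum_blockCounit_tmul_fibreMonomial hF hP
    exact congrArg AlgHom.toLinearMap h
  counit_right := by
    have h : (Algebra.TensorProduct.map (.id K _) (blockCounit K F)).comp
        (refinementCoproduct K F) = Algebra.TensorProduct.includeLeft := by
      refine bBl_algHom_ext fun P _ => ?_
      simp only [AlgHom.comp_apply, refinementCoproduct_blockClass, map_sum,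
        Algebra.TensorProduct.map_tmul, AlgHom.id_apply, Algebra.TensorProduct.includeLeft_apply]
      exact sum_coarsenings_counit (blockClass K) P
    exact congrArg AlgHom.toLinearMap h
  comul_one := map_one (refinementCoproduct K F)
  comul_mul := map_mul (refinementCoproduct K F)
  counit_one := map_one (blockCounit K F)
  counit_mul := map_mul (blockCounit K F)

/-! ### The coaction -/

lemma refinementCoaction_ι (P : Part₀ F) :
    refinementCoaction K F (FreeAlgebra.ι K P) =
      ∑ Q : Coarsening P, FreeAlgebra.ι K Q.toPart₀ ⊗ₜ[K] fibreMonomial K P Q.1 :=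
  FreeAlgebra.lift_ι_apply _ _

lemma isRightCoaction_refinementCoaction (hF : F.IsSubstitutive) : IsRightCoaction K
    (refinementCoproduct K F).toLinearMap (blockCounit K F).toLinearMap
    (refinementCoaction K F).toLinearMap where
  coassoc := by
    have h : (Algebra.TensorProduct.assoc K K K (BGap K F) (BBl K F) (BBl K F)).toAlgHom.comp
        ((Algebra.TensorProduct.map (refinementCoaction K F) (.id K _)).comp
          (refinementCoaction K F)) =
        (Algebra.TensorProduct.map (.id K _) (refinementCoproduct K F)).comp
          (refinementCoaction K F) := by
      refine FreeAlgebra.hom_ext (funext fun P => ?_)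
      simp only [Function.comp_apply, AlgHom.comp_apply, refinementCoaction_ι, map_sum,
        Algebra.TensorProduct.map_tmul, AlgHom.id_apply, TensorProduct.sum_tmul]
      exact sum_coarsenings_coassoc hF (FreeAlgebra.ι K) P
    exact congrArg AlgHom.toLinearMap h
  counit := by
    have h : (Algebra.TensorProduct.map (.id K _) (blockCounit K F)).comp
        (refinementCoaction K F) = Algebra.TensorProduct.includeLeft := by
      refine FreeAlgebra.hom_ext (funext fun P => ?_)
      simp only [Function.comp_apply, AlgHom.comp_apply, refinementCoaction_ι, map_sum,
        Algebra.TensorProduct.map_tmul, AlgHom.id_apply, Algebra.TensorProduct.includeLeft_apply]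
      exact sum_coarsenings_counit (FreeAlgebra.ι K) P
    exact congrArg AlgHom.toLinearMap h

/-- The counit of the gap-insertion bialgebra is a morphism of comodules. -/
lemma gapCounit_rTensor_refinementCoaction (a : BGap K F) :
    (gapCounit K F).toLinearMap.rTensor (BBl K F) (refinementCoaction K F a) =
      gapCounit K F a ⊗ₜ[K] 1 := by
  have h : (Algebra.TensorProduct.map (gapCounit K F) (.id K (BBl K F))).comp
      (refinementCoaction K F) = Algebra.TensorProduct.includeLeft.comp (gapCounit K F) := by
    refine FreeAlgebra.hom_ext (funext fun P => ?_)
    simp only [Function.comp_apply, AlgHom.comp_apply, refinementCoaction_ι, map_sum,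
      Algebra.TensorProduct.map_tmul, AlgHom.id_apply, Algebra.TensorProduct.includeLeft_apply,
      gapCounit_ι]
    by_cases hP : P.deg = 0
    · rw [sum_coarsenings_of_deg_eq_zero hP, fibreMonomial_of_deg_eq_zero hP]
      rfl
    · rw [if_neg hP, TensorProduct.zero_tmul]
      refine Finset.sum_eq_zero fun Q _ => ?_
      rw [if_neg (show Q.toPart₀.deg ≠ 0 from hP), TensorProduct.zero_tmul]
  exact DFunLike.congr_fun h a

/-- The coaction on a product over gaps. -/
lemma refinementCoaction_gapProduct (P : Part₀ F) (X : Finset (Fin P.deg)) :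
    refinementCoaction K F (gapProduct K P Finset.univ X) =
      ∑ q : ∀ i : Fin (X.card + 1), Coarsening (P.st (gap X i)),
        (List.ofFn fun i => FreeAlgebra.ι K (q i).toPart₀).prod ⊗ₜ[K]
          ∏ i : Fin (X.card + 1), fibreMonomial K (P.st (gap X i)) (q i).1 := by
  rw [gapProduct_univ, map_list_prod, List.map_ofFn]
  simp only [Function.comp_def, refinementCoaction_ι]
  rw [prod_ofFn_sum K, Fintype.piFinset_univ]
  simp only [prod_ofFn_tmul, List.prod_ofFn]

/-- The right-hand side of the compatibility between `Δ₀` and `ρ`, for one cut: families of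
coarsenings of `P|_X` and of the restrictions of `P` to the gaps of `X` glue to the coarsenings of
`P` for which `X` is still a cut. -/
lemma sum_coarsenings_cut (hF : F.IsSubstitutive) (P : Part₀ F) {X : Finset (Fin P.deg)}
    (hX : IsCut P.part X)
    [DecidablePred fun Q : Coarsening P => Q.1 ≤ kernelPartition (gapColor X)] :
    ∑ Q₀ : Coarsening (P.st X), ∑ q : ∀ i : Fin (X.card + 1), Coarsening (P.st (gap X i)),
        (FreeAlgebra.ι K Q₀.toPart₀ ⊗ₜ[K]
          (List.ofFn fun i => FreeAlgebra.ι K (q i).toPart₀).prod) ⊗ₜ[K]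
            (fibreMonomial K (P.st X) Q₀.1 *
              ∏ i : Fin (X.card + 1), fibreMonomial K (P.st (gap X i)) (q i).1) =
      ∑ Q : Coarsening P with Q.1 ≤ kernelPartition (gapColor X),
        (FreeAlgebra.ι K (Q.toPart₀.st X) ⊗ₜ[K] gapProduct K Q.toPart₀ Finset.univ X) ⊗ₜ[K]
          fibreMonomial K P Q.1 := by
  let f : (∀ j, Coarsening (P.st (gapFamily X j))) → (BGap K F ⊗[K] BGap K F) ⊗[K] BBl K F :=
    fun q => (FreeAlgebra.ι K (q none).toPart₀ ⊗ₜ[K]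
      (List.ofFn fun i => FreeAlgebra.ι K (q (some i)).toPart₀).prod) ⊗ₜ[K]
        ∏ j, fibreMonomial K (P.st (gapFamily X j)) (q j).1
  have key := sum_coarsenings_eq_sum_pi hF P (isFibres_gap X) (hF.mem_gaps X) (isCut_iff_le.1 hX) f
  trans ∑ q, f q
  · rw [← (Equiv.piOptionEquivProd (β := fun j => Coarsening (P.st (gapFamily X j)))).symm.sum_comp,
      Fintype.sum_prod_type]
    refine Finset.sum_congr rfl fun Q₀ _ => Finset.sum_congr rfl fun q _ => ?_
    simp only [f, Fintype.prod_option]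
    rfl
  · rw [← key]
    refine Finset.sum_congr rfl fun Q hQ => ?_
    refine congrArg₂ (· ⊗ₜ[K] ·) (congrArg₂ (· ⊗ₜ[K] ·) rfl ?_) ?_
    · exact (gapProduct_univ Q.toPart₀ X).symm
    · exact (fibreMonomial_eq_prod_of_isFibres P (isFibres_gap X) (Finset.mem_filter.1 hQ).2).symm

/-- The cut coproduct is a morphism of comodules: on a generator `P`, both sides run through the
pairs of a coarsening `Q` of `P` and a cut of `Q`. -/
lemma cutCoproduct_colinear (hF : F.IsSubstitutive) :
    (cutCoproduct K F).toLinearMap.rTensor (BBl K F) ∘ₗ (refinementCoaction K F).toLinearMap =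
      (LinearMap.mul' K (BBl K F)).lTensor (BGap K F ⊗[K] BGap K F) ∘ₗ
        (TensorProduct.tensorTensorTensorComm K (BGap K F) (BBl K F) (BGap K F)
          (BBl K F)).toLinearMap ∘ₗ
          TensorProduct.map (refinementCoaction K F).toLinearMap
            (refinementCoaction K F).toLinearMap ∘ₗ (cutCoproduct K F).toLinearMap := by
  classical
  have h : (Algebra.TensorProduct.map (cutCoproduct K F) (.id K (BBl K F))).comp
      (refinementCoaction K F) =
      (Algebra.TensorProduct.map (.id K (BGap K F ⊗[K] BGap K F))
        (Algebra.TensorProduct.lmul' (S := BBl K F) K)).comp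
        ((Algebra.TensorProduct.tensorTensorTensorComm K K K K (BGap K F) (BBl K F) (BGap K F)
          (BBl K F)).toAlgHom.comp
          ((Algebra.TensorProduct.map (refinementCoaction K F) (refinementCoaction K F)).comp
            (cutCoproduct K F))) := by
    refine FreeAlgebra.hom_ext (funext fun P => ?_)
    simp only [Function.comp_apply, AlgHom.comp_apply, refinementCoaction_ι, cutCoproduct_ι,
      map_sum, Algebra.TensorProduct.map_tmul, AlgHom.id_apply, TensorProduct.sum_tmul,
      refinementCoaction_gapProduct, TensorProduct.tmul_sum]
    trans ∑ X ∈ cuts P.part, ∑ Q : Coarsening P with Q.1 ≤ kernelPartition (gapColor X),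
        (FreeAlgebra.ι K (Q.toPart₀.st X) ⊗ₜ[K] gapProduct K Q.toPart₀ Finset.univ X) ⊗ₜ[K]
          fibreMonomial K P Q.1
    · refine Finset.sum_comm' (s := Finset.univ) (t := fun Q : Coarsening P => cuts Q.1)
        (f := fun Q X => (FreeAlgebra.ι K (Q.toPart₀.st X) ⊗ₜ[K]
          gapProduct K Q.toPart₀ Finset.univ X) ⊗ₜ[K] fibreMonomial K P Q.1) fun Q X => ?_
      simp only [Finset.mem_univ, true_and, Finset.mem_filter, ← isCut_iff_le, mem_cuts]
      exact ⟨fun h => ⟨h, h.mono Q.le⟩, fun h => h.1⟩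
    · refine Finset.sum_congr rfl fun X hX => ?_
      rw [← sum_coarsenings_cut hF P (mem_cuts.1 hX)]
      exact Finset.sum_comm
  exact congrArg AlgHom.toLinearMap h

/-- The comodule bialgebra attached to any class of partitions that is stable under restriction and
substitution. -/
theorem isComoduleBialgebra (hF : F.IsSubstitutive) : IsComoduleBialgebra K
    (cutCoproduct K F).toLinearMap (gapCounit K F).toLinearMap
    (refinementCoproduct K F).toLinearMap (blockCounit K F).toLinearMap
    (refinementCoaction K F).toLinearMap where
  bialgebra_left := isBialgebra_gap
  bialgebra_right := isBialgebra_block hF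
  coaction := isRightCoaction_refinementCoaction hF
  unital := map_one (refinementCoaction K F)
  multiplicative := map_mul (refinementCoaction K F)
  counital := gapCounit_rTensor_refinementCoaction
  comul_colinear := cutCoproduct_colinear hF

end PartitionBialgebra

theorem mainTheorem1 (K : Type*) [Field K] [CharZero K] :
    PartitionBialgebra.IsComoduleBialgebra K
      (PartitionBialgebra.cutCoproduct K PartitionBialgebra.noncrossingPartitions).toLinearMap
      (PartitionBialgebra.gapCounit K PartitionBialgebra.noncrossingPartitions).toLinearMap
      (PartitionBialgebra.refinementCoproduct K
        PartitionBialgebra.noncrossingPartitions).toLinearMap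
      (PartitionBialgebra.blockCounit K PartitionBialgebra.noncrossingPartitions).toLinearMap
      (PartitionBialgebra.refinementCoaction K
        PartitionBialgebra.noncrossingPartitions).toLinearMap ∧
    PartitionBialgebra.IsComoduleBialgebra K
      (PartitionBialgebra.cutCoproduct K PartitionBialgebra.allPartitions).toLinearMap
      (PartitionBialgebra.gapCounit K PartitionBialgebra.allPartitions).toLinearMap
      (PartitionBialgebra.refinementCoproduct K PartitionBialgebra.allPartitions).toLinearMap
      (PartitionBialgebra.blockCounit K PartitionBialgebra.allPartitions).toLinearMap
      (PartitionBialgebra.refinementCoaction K PartitionBialgebra.allPartitions).toLinearMap := by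
  exact ⟨PartitionBialgebra.isComoduleBialgebra
      PartitionBialgebra.isSubstitutive_noncrossingPartitions,
    PartitionBialgebra.isComoduleBialgebra PartitionBialgebra.isSubstitutive_allPartitions⟩
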